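/- Let $d\in\{2,3\}$ and let $G(x,y)=\frac1{2\pi}\log|x-y|$ if $d=2$, $G(x,y)=\frac1{4\pi|x-y|}$ if $d=3$. Put $s_2=1$, $s_3=-1$, so that $\Delta_x G(\cdot,y)=s_d\,\delta_y$. For $1\le i,j\le d$ let $f_{ij}$ be the angular part of $\partial_{x_i}\partial_{x_j}G$, i.e. $\partial_{x_i}\partial_{x_j}G(x,y)=f_{ij}\big(\tfrac{x-y}{|x-y|}\big)|x-y|^{-d}$; explicitly, for $\theta\in\mathbb S^{d-1}$, $$f_{ij}(\theta)=\tfrac1{2\pi}(\delta_{ij}-2\theta_i\theta_j)\ (d=2),\qquad f_{ij}(\theta)=-\tfrac1{4\pi}(\delta_{ij}-3\theta_i\theta_j)\ (d=3).$$ Let $D\subset\mathbb R^d$ be bounded, with boundary of finite $(d-1)$-dimensional measure $\sigma$ and of class $C^1$ (with $D$ locally on one side) outside a set of $\sigma$-measure zero; this includes bounded $C^{1,\alpha}$ domains and domains with piecewise smooth boundary. Let $\nu$ be the outward unit normal. Let $x$ be an interior point of $D$ and assume that $D$ is given in polar coordinates about $x$ by $$D=\Big\{y\in\mathbb R^d:\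 |x-y|\le\rho\Big(\frac{x-y}{|x-y|}\Big)\Big\},\qquad \rho:\mathbb S^{d-1}\to\mathbb R .$$ Let $\mathbf L_D(x)=\int_{\partial D}\nabla_x G(x,y)\,\nu(y)^{\top}\,d\sigma(y)$. Then for all $i,j$ the integrals below converge absolutely, and $$(\mathbf L_D(x))_{ij}=\int_{\partial D}\partial_{x_j}G(x,y)\,\nu(y)\cdot e_i\,d\sigma(y)=-\frac{s_d\,\delta_{ij}}{d}-\int_{\mathbb S^{d-1}}f_{ij}(\theta)\log\rho(\theta)\,d\theta .$$ Equivalently, with the normalisation $\Gamma=-s_dG$ (so that $-\Delta\Gamma=\delta$ in both dimensions; $\Gamma=G$ if $d=3$), with $h_{ij}=-s_df_{ij}$ the angular part of the second derivatives of $\Gamma$, and with the gradient taken in the integration variable, $$\int_{\partial D}\partial_{y_j}\Gamma(x,y)\,\nu(y)\cdot e_i\,d\sigma(y)=-\frac{\delta_{ij}}{d}+\int_{\mathbb S^{d-1}}h_{ij}(\theta)\log\rho(\theta)\,d\theta .$$ -/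

import Mathlib

open MeasureTheory Topology
open scoped Gradient

noncomputable section

/-- The Green function of the Laplacian of `ℝ ^ d` for `d = 2, 3`:
`(2π)⁻¹ log |x - y|` if `d = 2` and `(4π |x - y|)⁻¹` if `d = 3`. -/
def greenFn (d : ℕ) (x y : EuclideanSpace ℝ (Fin d)) : ℝ :=
  if d = 2 then 1 / (2 * Real.pi) * Real.log ‖x - y‖
  else 1 / (4 * Real.pi) * (1 / ‖x - y‖)

/-- The sign `s` with `Δ G = s δ`: it is `1` if `d = 2` and `-1` if `d = 3`. -/
def greenSign (d : ℕ) : ℝ := if d = 2 then 1 else -1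

/-- The Green function normalised so that it solves `-Δ Γ = δ` in both dimensions:
`-(2π)⁻¹ log |x - y|` if `d = 2` and `(4π |x - y|)⁻¹` if `d = 3`. -/
def newtonFn (d : ℕ) (x y : EuclideanSpace ℝ (Fin d)) : ℝ :=
  -greenSign d * greenFn d x y

/-- The partial derivative of `g` in the `j`-th coordinate direction at `z`. -/
def pderivAt {d : ℕ} (j : Fin d) (g : EuclideanSpace ℝ (Fin d) → ℝ)
    (z : EuclideanSpace ℝ (Fin d)) : ℝ :=
  fderiv ℝ g z (EuclideanSpace.single j 1)

/-- The Kronecker symbol. -/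
def kron {d : ℕ} (i j : Fin d) : ℝ := if i = j then 1 else 0

/-- The angular part `f i j` of the second derivatives of the Green function:
`∂ᵢ∂ⱼ G (x, y) = f i j ((x - y) / |x - y|) / |x - y| ^ d`. -/
def greenAngular {d : ℕ} (i j : Fin d) (θ : EuclideanSpace ℝ (Fin d)) : ℝ :=
  if d = 2 then 1 / (2 * Real.pi) * (kron i j - 2 * (θ i * θ j))
  else -(1 / (4 * Real.pi)) * (kron i j - 3 * (θ i * θ j))

/-- The angular part of the second derivatives of `newtonFn`. -/
def newtonAngular {d : ℕ} (i j : Fin d) (θ : EuclideanSpace ℝ (Fin d)) : ℝ :=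
  -greenSign d * greenAngular i j θ

/-- `n` is the outward unit normal of `D` at the boundary point `y`, where the boundary is of
class `C¹`: near `y`, the set `D` is `{φ ≤ 0}` for a `C¹` function `φ` whose gradient does not
vanish at `y`, and `n = ∇ φ y / |∇ φ y|`. -/
def IsOutwardNormal {d : ℕ} (D : Set (EuclideanSpace ℝ (Fin d)))
    (y n : EuclideanSpace ℝ (Fin d)) : Prop :=
  y ∈ frontier D ∧ ∃ φ : EuclideanSpace ℝ (Fin d) → ℝ,
    ContDiffAt ℝ 1 φ y ∧ ∇ φ y ≠ 0 ∧ (∀ᶠ z in 𝓝 y, z ∈ D ↔ φ z ≤ 0) ∧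
      n = ‖∇ φ y‖⁻¹ • ∇ φ y

/-- The boundary points near which the boundary of `D` is of class `C¹`, with `D` on one side. -/
def regularBoundary {d : ℕ} (D : Set (EuclideanSpace ℝ (Fin d))) :
    Set (EuclideanSpace ℝ (Fin d)) :=
  {y | ∃ n, IsOutwardNormal D y n}

open Classical in
/-- The outward unit normal field of `D` (and `0` away from the regular boundary points). -/
def outwardNormal {d : ℕ} (D : Set (EuclideanSpace ℝ (Fin d)))
    (y : EuclideanSpace ℝ (Fin d)) : EuclideanSpace ℝ (Fin d) :=
  if h : ∃ n, IsOutwardNormal D y n then h.choose else 0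

/-- The surface measure on the boundary of `D`: the `(d - 1)`-dimensional Hausdorff measure, in
the normalisation that agrees with the Lebesgue measure on hyperplanes. -/
def surfaceMeasure {d : ℕ} (D : Set (EuclideanSpace ℝ (Fin d))) :
    Measure (EuclideanSpace ℝ (Fin d)) :=
  (μHE[d - 1] : Measure (EuclideanSpace ℝ (Fin d))).restrict (frontier D)

/-- The boundary has finite surface measure, and it is of class `C¹` outside a set of surface
measure zero. Every bounded domain with `C¹` (in particular `C^{1,α}`) boundary satisfies this,
and so do domains with edges and corners. -/
def HasPiecewiseC1Boundary {d : ℕ} (D : Set (EuclideanSpace ℝ (Fin d))) : Prop :=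
  surfaceMeasure D Set.univ < ⊤ ∧ ∀ᵐ y ∂(surfaceMeasure D), y ∈ regularBoundary D

/-- The region `{y : |x - y| ≤ ρ ((x - y) / |x - y|)}`, written through `y = x - t θ` with
`θ = (x - y) / |x - y|` and `t = |x - y|`. -/
def polarRegion {d : ℕ} (x : EuclideanSpace ℝ (Fin d))
    (ρ : Metric.sphere (0 : EuclideanSpace ℝ (Fin d)) 1 → ℝ) :
    Set (EuclideanSpace ℝ (Fin d)) :=
  {y | ∃ θ : Metric.sphere (0 : EuclideanSpace ℝ (Fin d)) 1, ∃ t : ℝ,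
    0 ≤ t ∧ t ≤ ρ θ ∧ y = x - t • (θ : EuclideanSpace ℝ (Fin d))}

/-- The matrix `∫_{∂D} ∇ₓ G (x, y) ν(y)ᵀ dσ(y)`. -/
def dyadicL {d : ℕ} (D : Set (EuclideanSpace ℝ (Fin d))) (x : EuclideanSpace ℝ (Fin d)) :
    Matrix (Fin d) (Fin d) ℝ :=
  Matrix.of fun i j =>
    ∫ y, (∇ (fun z => greenFn d z y) x) i * (outwardNormal D y) j ∂(surfaceMeasure D)

end

/-! Away from the pole, `∂ⱼG = c wⱼ |w|^(-d)` with `w = x - y` and `c = greenConst d`. A ball of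
radius `b` about `x` lies in `D`, so the boundary never sees the singularity. Replacing `|w|^(-d)`
by `q(|w|²)`, where `q` is `C¹` and the two agree for `|w| ≥ b`, leaves the boundary integral
unchanged and makes the field `C¹` on all of `D`. No principal value is needed.

The divergence theorem turns the boundary integral into `-c ∫_D ∂ᵢ(wⱼ q)`. In polar coordinates the
radial integral up to `ρ(θ)` is explicit (`integral_radialDeriv`): it equals `θᵢθⱼ + (δᵢⱼ - dθᵢθⱼ)(C
+ log ρ(θ))`. The angular factor `δᵢⱼ - dθᵢθⱼ` has mean zero, so the constant `C`, which depends on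
the choice of `q`, drops out. The term `θᵢθⱼ` integrates to `δᵢⱼ|B|`, and `c|B| = s_d/d`. What
remains is `f_ij log ρ`.

Most of the work is the divergence theorem for piecewise `C¹` boundaries
(`setIntegral_fderiv_eq_integral_surfaceMeasure`), proved without an area formula. Near a regular
point `D` is a half-space up to a relative Lipschitz error `ε`. For a nonnegative test function `g`
supported there, the two sides differ by at most `η‖v‖ ∫ g dσ`, with `η` small with `ε`. The normal
derivative is integrated by Fubini, the surface measure is compared with the tangent hyperplane by
Lipschitz bounds, and tangential derivatives are controlled because translations in a cone about
`-n` map `D` into itself locally. The errors add up over a partition of unity to `η‖v‖ ∫ g dσ`, and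
`η` is arbitrary. The singular boundary set is compact and `σ`-null, so cutoffs whose derivatives
tend to zero in `L¹` remove it (`exists_cutoff`). -/

noncomputable section

open Metric Set Filter
open scoped RealInnerProductSpace NNReal

/-! ### Half-space charts -/

section Chart

variable {E : Type*} [NormedAddCommGroup E] [InnerProductSpace ℝ E]

/-- Near `y`, the set `D` is the sublevel set `{ψ ≤ 0}` of a function `ψ` that differs from the
linear function `⟪n, ·⟫` by a function with Lipschitz constant `ε`. -/
structure HalfSpaceChart (D : Set E) (y n : E) (ε r : ℝ) (ψ : E → ℝ) : Prop where
  norm_eq_one : ‖n‖ = 1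
  eps_pos : 0 < ε
  eps_le : ε ≤ 1 / 4
  radius_pos : 0 < r
  base : ψ y = 0
  approx : ∀ z ∈ ball y r, ∀ w ∈ ball y r, |ψ z - ψ w - ⟪n, z - w⟫| ≤ ε * ‖z - w‖
  mem_iff : ∀ z ∈ ball y r, z ∈ D ↔ ψ z ≤ 0

namespace HalfSpaceChart

variable {D : Set E} {y n : E} {ε r : ℝ} {ψ : E → ℝ}

lemma le_add (H : HalfSpaceChart D y n ε r ψ) {z w : E} (hz : z ∈ ball y r)
    (hw : w ∈ ball y r) : ψ z ≤ ψ w + ⟪n, z - w⟫ + ε * ‖z - w‖ := by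
  have := abs_le.1 (H.approx z hz w hw)
  linarith [this.2]

lemma inner_self (H : HalfSpaceChart D y n ε r ψ) : ⟪n, n⟫ = 1 := by
  rw [real_inner_self_eq_norm_sq, H.norm_eq_one, one_pow]

lemma continuousOn (H : HalfSpaceChart D y n ε r ψ) : ContinuousOn ψ (ball y r) := by
  have : LipschitzOnWith 2 ψ (ball y r) := by
    refine LipschitzOnWith.of_dist_le_mul fun z hz w hw => ?_
    have h1 := H.approx z hz w hw
    have h2 : |⟪n, z - w⟫| ≤ ‖z - w‖ := by
      simpa [H.norm_eq_one] using abs_real_inner_le_norm n (z - w)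
    rw [Real.dist_eq, dist_eq_norm]
    have h3 := abs_sub_abs_le_abs_sub (ψ z - ψ w) ⟪n, z - w⟫
    have h4 := H.eps_le
    push_cast
    nlinarith [norm_nonneg (z - w)]
  exact this.continuousOn

/-- In a chart the frontier is the zero set of the defining function. -/
lemma mem_frontier_iff (H : HalfSpaceChart D y n ε r ψ) {z : E} (hz : z ∈ ball y r) :
    z ∈ frontier D ↔ ψ z = 0 := by
  have hnhds : ball y r ∈ 𝓝 z := isOpen_ball.mem_nhds hz
  have hcont : ContinuousAt ψ z := H.continuousOn.continuousAt hnhds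
  have hlim : ∀ c : ℝ, Tendsto (fun τ : ℝ => z + (τ * c) • n) (𝓝[>] 0) (𝓝 z) := fun c => by
    have : Continuous fun τ : ℝ => z + (τ * c) • n := by fun_prop
    simpa using (this.tendsto 0).mono_left nhdsWithin_le_nhds
  constructor
  · intro hf
    rcases lt_trichotomy (ψ z) 0 with h | h | h
    · refine absurd ?_ hf.2
      rw [mem_interior_iff_mem_nhds]
      filter_upwards [hnhds, hcont.eventually_lt_const h] with w hw hw'
      exact (H.mem_iff w hw).2 hw'.le
    · exact h
    · refine absurd hf.1 ?_
      rw [← mem_compl_iff, ← interior_compl, mem_interior_iff_mem_nhds]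
      filter_upwards [hnhds, hcont.eventually_const_lt h] with w hw hw'
      exact fun hD => absurd ((H.mem_iff w hw).1 hD) (not_le.2 hw')
  · intro h
    -- Moving from a zero of `ψ` by `τc` along `n` changes `ψ` by `τc` up to a fraction `ε`; `c =
    -- -1` enters `D` and `c = 1` leaves it.
    have key : ∀ c : ℝ, ∀ᶠ τ in 𝓝[>] (0 : ℝ), 0 < τ ∧ z + (τ * c) • n ∈ ball y r ∧
        |ψ (z + (τ * c) • n) - τ * c| ≤ ε * |τ * c| := by
      intro c
      filter_upwards [self_mem_nhdsWithin, hlim c hnhds] with τ hτ hb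
      refine ⟨hτ, hb, ?_⟩
      have := H.approx _ hb z hz
      rw [h] at this
      simpa [inner_smul_right, H.inner_self, norm_smul, H.norm_eq_one] using this
    refine ⟨?_, ?_⟩
    · refine mem_closure_of_tendsto (hlim (-1)) ?_
      filter_upwards [key (-1)] with τ hτ
      refine (H.mem_iff _ hτ.2.1).2 ?_
      have h1 := (abs_le.1 hτ.2.2).2
      rw [abs_of_neg (by linarith [hτ.1])] at h1
      nlinarith [hτ.1, H.eps_le]
    · rw [← mem_compl_iff, ← closure_compl]
      refine mem_closure_of_tendsto (hlim 1) ?_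
      filter_upwards [key 1] with τ hτ
      refine fun hD => absurd ((H.mem_iff _ hτ.2.1).1 hD) (not_le.2 ?_)
      have h1 := (abs_le.1 hτ.2.2).1
      rw [abs_of_pos (by linarith [hτ.1])] at h1
      nlinarith [hτ.1, H.eps_le]

end HalfSpaceChart

end Chart

/-! ### The outward normal: charts, uniqueness, continuity, measurability -/

section Normal

variable {d : ℕ} {D : Set (EuclideanSpace ℝ (Fin d))} {y n : EuclideanSpace ℝ (Fin d)}

/-- A `C¹` function is strictly differentiable, which gives the two-point estimate of a chart; the
defining function only has to be divided by the norm of its gradient. -/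
lemma IsOutwardNormal.exists_chart (h : IsOutwardNormal D y n) {ε : ℝ} (hε : 0 < ε)
    (hε' : ε ≤ 1 / 4) : ∃ r ψ, HalfSpaceChart D y n ε r ψ := by
  obtain ⟨hy, φ, hφ, hne, hD, rfl⟩ := h
  have ha : 0 < ‖∇ φ y‖ := norm_pos_iff.2 hne
  have hcont : ContinuousAt φ y := hφ.continuousAt
  have hφy : φ y = 0 := by
    rcases lt_trichotomy (φ y) 0 with h | h | h
    · refine absurd ?_ hy.2
      rw [mem_interior_iff_mem_nhds]
      filter_upwards [hD, hcont.eventually_lt_const h] with w hw hw'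
      exact hw.2 hw'.le
    · exact h
    · refine absurd hy.1 ?_
      rw [← mem_compl_iff, ← interior_compl, mem_interior_iff_mem_nhds]
      filter_upwards [hD, hcont.eventually_const_lt h] with w hw hw'
      exact fun hD => absurd (hw.1 hD) (not_le.2 hw')
  have hs := (hφ.hasStrictFDerivAt one_ne_zero).isLittleO
  have h1 := Asymptotics.isLittleO_iff.1 hs (mul_pos hε ha)
  rw [nhds_prod_eq] at h1
  obtain ⟨u, hu, hu'⟩ := Filter.eventually_prod_self_iff'.1 h1
  obtain ⟨r, hr, hball⟩ := Metric.mem_nhds_iff.1 (inter_mem hu hD)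
  refine ⟨r, fun z => ‖∇ φ y‖⁻¹ * φ z, ⟨?_, hε, hε', hr, by simp [hφy], ?_, ?_⟩⟩
  · rw [norm_smul, norm_inv, norm_norm, inv_mul_cancel₀ ha.ne']
  · intro z hz w hw
    have h2 := hu' z (hball hz).1 w (hball hw).1
    simp only at h2
    rw [← inner_gradient_left] at h2
    have : ‖∇ φ y‖⁻¹ * φ z - ‖∇ φ y‖⁻¹ * φ w - ⟪‖∇ φ y‖⁻¹ • ∇ φ y, z - w⟫
        = ‖∇ φ y‖⁻¹ * (φ z - φ w - ⟪∇ φ y, z - w⟫) := by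
      rw [real_inner_smul_left]; ring
    rw [this, abs_mul, abs_of_pos (inv_pos.2 ha), inv_mul_le_iff₀ ha, ← Real.norm_eq_abs]
    calc _ ≤ _ := h2
      _ = _ := by ring
  · intro z hz
    have h3 : z ∈ D ↔ φ z ≤ 0 := (hball hz).2
    rw [h3]
    constructor
    · exact fun h => mul_nonpos_of_nonneg_of_nonpos (inv_pos.2 ha).le h
    · exact fun h => nonpos_of_mul_nonpos_right h (inv_pos.2 ha)

lemma IsOutwardNormal.norm_eq_one (h : IsOutwardNormal D y n) : ‖n‖ = 1 := by
  obtain ⟨r, ψ, H⟩ := h.exists_chart (ε := 1 / 4) (by norm_num) le_rfl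
  exact H.norm_eq_one

/-- If `n ≠ n'`, the direction `n' - n` has negative inner product with `n` and positive inner
product with `n'`, so it would point both into and out of `D`. Uniqueness identifies the chosen
value of `outwardNormal` with the normal of any defining function. -/
lemma IsOutwardNormal.unique {n' : EuclideanSpace ℝ (Fin d)} (h : IsOutwardNormal D y n)
    (h' : IsOutwardNormal D y n') : n = n' := by
  by_contra hne
  set v := n' - n with hv
  have hvpos : 0 < ‖v‖ := norm_pos_iff.2 (sub_ne_zero.2 (Ne.symm hne))
  -- With `ε ≤ ‖v‖ / 4` the chart error `ετ‖v‖` is at most half of the linear term `τ‖v‖² / 2`.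
  set ε := min (1 / 4) (‖v‖ / 4) with hε
  have hεpos : 0 < ε := lt_min (by norm_num) (by linarith)
  have hε4 : ε ≤ ‖v‖ / 4 := min_le_right _ _
  obtain ⟨r, ψ, H⟩ := h.exists_chart hεpos (min_le_left _ _)
  obtain ⟨r', ψ', H'⟩ := h'.exists_chart hεpos (min_le_left _ _)
  have hlim : Tendsto (fun τ : ℝ => y + τ • v) (𝓝[>] 0) (𝓝 y) := by
    have : Continuous fun τ : ℝ => y + τ • v := by fun_prop
    simpa using (this.tendsto 0).mono_left nhdsWithin_le_nhds
  obtain ⟨τ, hτ, hb, hb'⟩ := ((eventually_mem_nhdsWithin (s := Ioi (0 : ℝ))).and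
    ((hlim.eventually (ball_mem_nhds y H.radius_pos)).and
      (hlim.eventually (ball_mem_nhds y H'.radius_pos)))).exists
  replace hτ : 0 < τ := hτ
  have hsq : ‖v‖ ^ 2 = 2 - 2 * ⟪n, n'⟫ := by
    rw [hv, norm_sub_sq_real, h.norm_eq_one, h'.norm_eq_one, real_inner_comm]; ring
  have hnv : ⟪n, v⟫ = -(‖v‖ ^ 2 / 2) := by
    rw [hsq, hv, inner_sub_right, H.inner_self]; ring
  have hnv' : ⟪n', v⟫ = ‖v‖ ^ 2 / 2 := by
    rw [hsq, hv, inner_sub_right, H'.inner_self, real_inner_comm]; ring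
  have e1 := H.approx _ hb y (mem_ball_self H.radius_pos)
  have e2 := H'.approx _ hb' y (mem_ball_self H'.radius_pos)
  rw [H.base, sub_zero, add_sub_cancel_left, real_inner_smul_right, hnv, norm_smul,
    Real.norm_of_nonneg hτ.le, abs_le] at e1
  rw [H'.base, sub_zero, add_sub_cancel_left, real_inner_smul_right, hnv', norm_smul,
    Real.norm_of_nonneg hτ.le, abs_le] at e2
  have hεv : ε * (τ * ‖v‖) ≤ τ * ‖v‖ ^ 2 / 4 := by
    have : 0 ≤ τ * ‖v‖ := by positivity
    nlinarith
  have hpos : 0 < τ * ‖v‖ ^ 2 := by positivity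
  have hin : y + τ • v ∈ D := (H.mem_iff _ hb).2 (by linarith [e1.2])
  have := (H'.mem_iff _ hb').1 hin
  linarith [e2.1]

lemma IsOutwardNormal.outwardNormal_eq (h : IsOutwardNormal D y n) : outwardNormal D y = n := by
  have hex : ∃ n, IsOutwardNormal D y n := ⟨n, h⟩
  rw [outwardNormal, dif_pos hex]
  exact hex.choose_spec.unique h

/-- Near a regular boundary point all frontier points are regular, and the normal is
continuous. -/
lemma IsOutwardNormal.eventually_near (h : IsOutwardNormal D y n) {ε : ℝ} (hε : 0 < ε) :
    ∀ᶠ z in 𝓝 y, z ∈ frontier D → z ∈ regularBoundary D ∧ ‖outwardNormal D z - n‖ ≤ ε := by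
  obtain ⟨hy, φ, hφ, hne, hD, rfl⟩ := h
  have hcd : ∀ᶠ z in 𝓝 y, ContDiffAt ℝ 1 φ z := hφ.eventually (by simp)
  have hgrad : ContinuousAt (∇ φ) y := by
    have := (hφ.fderiv_right (m := 0) (by simp)).continuousAt
    exact (InnerProductSpace.toDual ℝ _).symm.continuous.continuousAt.comp this
  have hne' : ∀ᶠ z in 𝓝 y, ∇ φ z ≠ 0 := hgrad.eventually_ne hne
  have hn : ContinuousAt (fun z => ‖∇ φ z‖⁻¹ • ∇ φ z) y :=
    (hgrad.norm.inv₀ (norm_ne_zero_iff.2 hne)).smul hgrad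
  have hclose := Metric.tendsto_nhds.1 hn.tendsto ε hε
  -- The same `φ` defines `D` near every nearby frontier point, so the normals there are its
  -- normalised gradients.
  filter_upwards [hcd, hne', eventually_eventually_nhds.2 hD, hclose] with z h1 h2 h3 h4 hz
  have hnormal : IsOutwardNormal D z (‖∇ φ z‖⁻¹ • ∇ φ z) := ⟨hz, φ, h1, h2, h3, rfl⟩
  refine ⟨⟨_, hnormal⟩, ?_⟩
  rw [hnormal.outwardNormal_eq, ← dist_eq_norm]
  exact h4.le

lemma isOutwardNormal_outwardNormal (hy : y ∈ regularBoundary D) :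
    IsOutwardNormal D y (outwardNormal D y) := by
  obtain ⟨n, hn⟩ := hy
  rwa [hn.outwardNormal_eq]

lemma regularBoundary_subset_frontier : regularBoundary D ⊆ frontier D := fun _ ⟨_, h⟩ => h.1

lemma outwardNormal_of_notMem (hy : y ∉ regularBoundary D) : outwardNormal D y = 0 := by
  have hex : ¬ ∃ n, IsOutwardNormal D y n := hy
  rw [outwardNormal, dif_neg hex]

lemma norm_outwardNormal_le (z : EuclideanSpace ℝ (Fin d)) : ‖outwardNormal D z‖ ≤ 1 := by
  by_cases h : z ∈ regularBoundary D
  · exact (isOutwardNormal_outwardNormal h).norm_eq_one.le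
  · simp [outwardNormal_of_notMem h]

lemma continuousOn_outwardNormal : ContinuousOn (outwardNormal D) (regularBoundary D) := by
  intro y hy
  rw [ContinuousWithinAt, Metric.tendsto_nhds]
  intro ε hε
  have h := (isOutwardNormal_outwardNormal hy).eventually_near (half_pos hε)
  filter_upwards [self_mem_nhdsWithin, nhdsWithin_le_nhds h] with z hz h
  rw [dist_eq_norm]
  linarith [(h (regularBoundary_subset_frontier hz)).2]

lemma exists_isOpen_regularBoundary_eq :
    ∃ U, IsOpen U ∧ regularBoundary D = frontier D ∩ U := by
  refine ⟨interior {z | z ∈ frontier D → z ∈ regularBoundary D}, isOpen_interior, ?_⟩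
  ext z
  refine ⟨fun hz => ⟨regularBoundary_subset_frontier hz, ?_⟩, fun hz => interior_subset hz.2 hz.1⟩
  rw [mem_interior_iff_mem_nhds]
  filter_upwards [(isOutwardNormal_outwardNormal hz).eventually_near one_pos] with w hw hw'
  exact (hw hw').1

lemma isClosed_frontier_diff_regularBoundary : IsClosed (frontier D \ regularBoundary D) := by
  obtain ⟨U, hU, h⟩ := exists_isOpen_regularBoundary_eq (D := D)
  rw [h, sdiff_self_inter]
  exact isClosed_frontier.sdiff hU

lemma measurableSet_regularBoundary : MeasurableSet (regularBoundary D) := by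
  obtain ⟨U, hU, h⟩ := exists_isOpen_regularBoundary_eq (D := D)
  rw [h]
  exact isClosed_frontier.measurableSet.inter hU.measurableSet

lemma measurable_outwardNormal : Measurable (outwardNormal D) := by
  classical
  have h : outwardNormal D = (regularBoundary D).piecewise (outwardNormal D) (fun _ => 0) := by
    ext1 z
    by_cases hz : z ∈ regularBoundary D
    · rw [piecewise_eq_of_mem _ _ _ hz]
    · rw [piecewise_eq_of_notMem _ _ _ hz, outwardNormal_of_notMem hz]
  rw [h]
  exact ContinuousOn.measurable_piecewise continuousOn_outwardNormal continuousOn_const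
    measurableSet_regularBoundary

end Normal

/-- The normalising factor of `μHE[k]` depends only on `k`, so it cancels and the bound for `μH[k]`
carries over. -/
lemma LipschitzOnWith.euclideanHausdorffMeasure_image_le {X Y : Type*} [MetricSpace X]
    [MeasurableSpace X] [BorelSpace X] [MetricSpace Y] [MeasurableSpace Y] [BorelSpace Y]
    {K : ℝ≥0} {f : X → Y} {s : Set X} (h : LipschitzOnWith K f s) (k : ℕ) :
    (μHE[k] : Measure Y) (f '' s) ≤ (K : ENNReal) ^ k * (μHE[k] : Measure X) s := by
  rw [Measure.euclideanHausdorffMeasure_def, Measure.euclideanHausdorffMeasure_def,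
    Measure.smul_apply, Measure.smul_apply, mul_smul_comm]
  have := h.hausdorffMeasure_image_le (d := k) (Nat.cast_nonneg k)
  rw [ENNReal.rpow_natCast] at this
  gcongr

/-! ### Directional derivatives of `C¹` functions, compactly supported where needed -/

section Integrals

variable {E : Type*} [NormedAddCommGroup E] [NormedSpace ℝ E]

lemma HasCompactSupport.fderiv_apply' {g : E → ℝ} (hc : HasCompactSupport g) (v : E) :
    HasCompactSupport fun z => fderiv ℝ g z v :=
  hc.fderiv_apply (𝕜 := ℝ) v

lemma ContDiff.continuous_fderiv_apply' {g : E → ℝ} (hg : ContDiff ℝ 1 g) (v : E) :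
    Continuous fun z => fderiv ℝ g z v :=
  (hg.continuous_fderiv one_ne_zero).clm_apply continuous_const

lemma integrable_fderiv_apply [MeasurableSpace E] [OpensMeasurableSpace E] {μ : Measure E}
    [IsFiniteMeasureOnCompacts μ] {g : E → ℝ} (hg : ContDiff ℝ 1 g)
    (hc : HasCompactSupport g) (v : E) : Integrable (fun z => fderiv ℝ g z v) μ :=
  (hg.continuous_fderiv_apply' v).integrable_of_hasCompactSupport (hc.fderiv_apply' v)

lemma fderiv_apply_eq_zero_of_notMem_tsupport {g : E → ℝ} {z : E} (hz : z ∉ tsupport g) (v : E) :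
    fderiv ℝ g z v = 0 := by
  rw [fderiv_of_notMem_tsupport (𝕜 := ℝ) hz]; rfl

lemma hasDerivAt_line {g : E → ℝ} (hg : ContDiff ℝ 1 g) (z u : E) (τ : ℝ) :
    HasDerivAt (fun τ : ℝ => g (z + τ • u)) (fderiv ℝ g (z + τ • u) u) τ := by
  have h1 := ((hg.differentiable one_ne_zero) (z + τ • u)).hasFDerivAt
  have h2 : HasDerivAt (fun τ : ℝ => z + τ • u) u τ := by
    simpa using ((hasDerivAt_id τ).smul_const u).const_add z
  exact h1.comp_hasDerivAt τ h2

end Integrals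

/-! ### Cylindrical coordinates along the normal -/

section Cylinder

variable {E : Type*} [NormedAddCommGroup E] [InnerProductSpace ℝ E]

lemma coe_toSpanUnitSingleton {n : E} (hn : ‖n‖ = 1) (t : ℝ) :
    (LinearIsometryEquiv.toSpanUnitSingleton (𝕜 := ℝ) n hn t : E) = t • n := rfl

/-- Cylindrical coordinates about `y` with axis `n`. -/
def cylMap (y n : E) (q : ℝ × (ℝ ∙ n)ᗮ) : E := y + q.1 • n + q.2

lemma continuous_cylMap (y n : E) : Continuous (cylMap y n) := by
  unfold cylMap; fun_prop

lemma inner_orthogonal_span (n : E) (p : (ℝ ∙ n)ᗮ) : ⟪n, (p : E)⟫ = 0 :=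
  Submodule.mem_orthogonal_singleton_iff_inner_right.1 p.2

lemma norm_cylMap_sub_sq {n : E} (hn : ‖n‖ = 1) (y : E) (q : ℝ × (ℝ ∙ n)ᗮ) :
    ‖cylMap y n q - y‖ ^ 2 = q.1 ^ 2 + ‖q.2‖ ^ 2 := by
  have : cylMap y n q - y = q.1 • n + q.2 := by simp [cylMap, add_assoc]
  rw [this, norm_add_sq_real, real_inner_smul_left, inner_orthogonal_span, norm_smul, hn]
  simp

lemma abs_fst_le_norm_cylMap_sub {n : E} (hn : ‖n‖ = 1) (y : E) (q : ℝ × (ℝ ∙ n)ᗮ) :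
    |q.1| ≤ ‖cylMap y n q - y‖ := by
  rw [← abs_norm, ← sq_le_sq, norm_cylMap_sub_sq hn]
  nlinarith [sq_nonneg ‖q.2‖]

lemma norm_snd_le_norm_cylMap_sub {n : E} (hn : ‖n‖ = 1) (y : E) (q : ℝ × (ℝ ∙ n)ᗮ) :
    ‖q.2‖ ≤ ‖cylMap y n q - y‖ := by
  rw [← abs_norm, ← abs_norm (cylMap y n q - y), ← sq_le_sq, norm_cylMap_sub_sq hn]
  nlinarith [sq_nonneg q.1]

lemma norm_cylMap_sub_le {n : E} (hn : ‖n‖ = 1) (y : E) (q : ℝ × (ℝ ∙ n)ᗮ) :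
    ‖cylMap y n q - y‖ ≤ |q.1| + ‖q.2‖ := by
  refine abs_le_of_sq_le_sq' ?_ (by positivity) |>.2
  rw [norm_cylMap_sub_sq hn]
  nlinarith [sq_abs q.1, mul_nonneg (abs_nonneg q.1) (norm_nonneg q.2)]

end Cylinder

/-! ### Derivatives over a chart as rates of change under translation -/

section Chart

variable {E : Type*} [NormedAddCommGroup E] [InnerProductSpace ℝ E] [FiniteDimensional ℝ E]
  [MeasurableSpace E] [BorelSpace E]

/-- The difference quotients are bounded by a Lipschitz constant of `g` times `‖u‖`, which is
integrable over a set of finite volume. -/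
lemma hasDerivAt_setIntegral_translate {D : Set E} (hfin : volume D ≠ ⊤) {g : E → ℝ}
    (hg : ContDiff ℝ 1 g) (hc : HasCompactSupport g) (u : E) :
    HasDerivAt (fun τ : ℝ => ∫ z in D, g (z + τ • u)) (∫ z in D, fderiv ℝ g z u) 0 := by
  obtain ⟨C, hC⟩ := hg.lipschitzWith_of_hasCompactSupport hc one_ne_zero
  have : Fact (volume D < ⊤) := ⟨hfin.lt_top⟩
  have hint : ∀ τ : ℝ, Integrable (fun z => g (z + τ • u)) := fun τ =>
    (hg.continuous.integrable_of_hasCompactSupport hc).comp_add_right (τ • u)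
  refine (hasDerivAt_integral_of_dominated_loc_of_lip (μ := volume.restrict D) (s := univ)
    (F := fun (τ : ℝ) z => g (z + τ • u)) (F' := fun z => fderiv ℝ g z u)
    (bound := fun _ => C * ‖u‖) univ_mem (Eventually.of_forall fun τ =>
      (hint τ).integrableOn.aestronglyMeasurable) (hint 0).integrableOn
      (integrable_fderiv_apply hg hc u).integrableOn.aestronglyMeasurable
      (ae_of_all _ fun z => ?_) (integrable_const _) (ae_of_all _ fun z => ?_)).2
  · refine LipschitzOnWith.of_dist_le_mul fun s _ t _ => ?_
    calc dist (g (z + s • u)) (g (z + t • u)) ≤ C * dist (z + s • u) (z + t • u) :=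
          hC.dist_le_mul _ _
      _ = C * ‖u‖ * dist s t := by
          rw [dist_add_left, dist_eq_norm, ← sub_smul, norm_smul, Real.dist_eq, Real.norm_eq_abs]
          ring
      _ = _ := by
          rw [Real.coe_nnabs, abs_of_nonneg (by positivity)]
  · simpa using hasDerivAt_line hg z u 0

namespace HalfSpaceChart

variable {D : Set E} {y n : E} {ε r : ℝ} {ψ : E → ℝ}

/-- The integral over `D` of the derivative of a nonnegative function in a direction close to the
outward normal is nonnegative. -/
lemma setIntegral_fderiv_nonneg (H : HalfSpaceChart D y n ε r ψ)
    (hD : NullMeasurableSet D) (hfin : volume D ≠ ⊤) {g : E → ℝ} (hg : ContDiff ℝ 1 g)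
    (hc : HasCompactSupport g) (hsupp : tsupport g ⊆ ball y r) (h0 : ∀ z, 0 ≤ g z) {u : E}
    (hu : ε * ‖u‖ ≤ ⟪n, u⟫) : 0 ≤ ∫ z in D, fderiv ℝ g z u := by
  obtain ⟨δ, hδ, hthick⟩ := hc.isCompact.exists_thickening_subset_open isOpen_ball hsupp
  have hlim := (hasDerivAt_setIntegral_translate hfin hg hc u).tendsto_slope_zero_right
  refine ge_of_tendsto hlim ?_
  have hsmall : ∀ᶠ τ in 𝓝[>] (0 : ℝ), ‖τ • u‖ < δ := by
    have : Continuous fun τ : ℝ => ‖τ • u‖ := by fun_prop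
    exact nhdsWithin_le_nhds ((this.tendsto 0).eventually_lt_const (by simpa using hδ))
  filter_upwards [hsmall, self_mem_nhdsWithin] with τ hτ hτ0
  replace hτ0 : 0 < τ := hτ0
  have hgi : Integrable g := hg.continuous.integrable_of_hasCompactSupport hc
  refine smul_nonneg (inv_nonneg.2 hτ0.le) (sub_nonneg.2 ?_)
  simp only [zero_add, zero_smul, add_zero]
  -- After a translation of the variable, the integral of `g` over `D` is compared with that over `D
  -- + τu`. It remains to see that `D ∩ tsupport g` lies in `D + τu`, which is the cone condition on
  -- `u`.
  rw [← integral_indicator₀ hD, ← integral_indicator₀ hD,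
    ← integral_sub_right_eq_self (D.indicator fun z => g (z + τ • u)) (τ • u)]
  refine integral_mono (hgi.indicator₀ hD)
    (((hgi.comp_add_right (τ • u)).indicator₀ hD).comp_sub_right (τ • u)) fun z => ?_
  by_cases hz : z ∈ D
  swap
  · rw [indicator_of_notMem hz]
    exact indicator_nonneg (fun w _ => h0 _) _
  by_cases hz' : z ∈ tsupport g
  swap
  · rw [indicator_of_mem hz, image_eq_zero_of_notMem_tsupport hz']
    exact indicator_nonneg (fun w _ => h0 _) _
  have hb : z - τ • u ∈ ball y r := by
    refine hthick (mem_thickening_iff.2 ⟨z, hz', ?_⟩)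
    rw [dist_eq_norm, sub_sub_cancel_left, norm_neg]
    exact hτ
  have hmem : z - τ • u ∈ D := by
    refine (H.mem_iff _ hb).2 ?_
    have h1 := H.le_add hb (hsupp hz')
    rw [sub_sub_cancel_left, inner_neg_right, real_inner_smul_right, norm_neg, norm_smul,
      Real.norm_of_nonneg hτ0.le] at h1
    have h2 := (H.mem_iff _ (hsupp hz')).1 hz
    nlinarith
  rw [indicator_of_mem hz, indicator_of_mem hmem, sub_add_cancel]

lemma abs_setIntegral_fderiv_le (H : HalfSpaceChart D y n ε r ψ)
    (hD : NullMeasurableSet D) (hfin : volume D ≠ ⊤) {g : E → ℝ} (hg : ContDiff ℝ 1 g)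
    (hc : HasCompactSupport g) (hsupp : tsupport g ⊆ ball y r) (h0 : ∀ z, 0 ≤ g z) {w : E}
    (hw : ⟪n, w⟫ = 0) :
    |∫ z in D, fderiv ℝ g z w| ≤ 2 * ε * ‖w‖ * ∫ z in D, fderiv ℝ g z n := by
  have key : ∀ w : E, ⟪n, w⟫ = 0 → 0 ≤ (∫ z in D, fderiv ℝ g z w) +
      2 * ε * ‖w‖ * ∫ z in D, fderiv ℝ g z n := by
    intro w hw
    have hint := fun v => (integrable_fderiv_apply (μ := volume) hg hc v).integrableOn (s := D)
    rw [← integral_const_mul, ← integral_add (hint w) ((hint n).const_mul _)]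
    -- Tilting the tangential vector `w` by `2ε‖w‖` towards `n` puts it in the admissible cone: `ε(1
    -- + 2ε)‖w‖ ≤ 2ε‖w‖` since `ε ≤ 1/4`.
    have h1 := H.setIntegral_fderiv_nonneg hD hfin hg hc hsupp h0
      (u := w + (2 * ε * ‖w‖) • n) ?_
    · simpa using h1
    · rw [inner_add_right, hw, real_inner_smul_right, H.inner_self, zero_add, mul_one]
      have h2 : ‖w + (2 * ε * ‖w‖) • n‖ ≤ ‖w‖ + 2 * ε * ‖w‖ := by
        refine (norm_add_le _ _).trans ?_
        rw [norm_smul, H.norm_eq_one, mul_one, Real.norm_of_nonneg]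
        have := H.eps_pos
        positivity
      have h3 := H.eps_le
      have h4 := H.eps_pos
      have h5 : 0 ≤ ε * ‖w‖ := by positivity
      nlinarith
  have h1 := key w hw
  have h2 := key (-w) (by rw [inner_neg_right, hw, neg_zero])
  simp only [map_neg, integral_neg, norm_neg] at h2
  rw [abs_le]
  constructor <;> linarith

end HalfSpaceChart

/-- The coordinates are an orthogonal splitting into the line along `n` and its complement, followed
by a translation. -/
lemma measurePreserving_cylMap {n : E} (hn : ‖n‖ = 1) (y : E) :
    MeasurePreserving (cylMap y n) volume volume := by
  have h1 := ((ℝ ∙ n).measurePreserving_measurableEquivProd y).symm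
  rw [InnerProductSpace.euclideanHausdorffMeasure_eq_volume] at h1
  have h2 : MeasurePreserving (Prod.map (LinearIsometryEquiv.toSpanUnitSingleton (𝕜 := ℝ) n hn)
      (id : (ℝ ∙ n)ᗮ → (ℝ ∙ n)ᗮ)) volume volume :=
    (LinearIsometryEquiv.measurePreserving _).prod (MeasurePreserving.id volume)
  have h3 : cylMap y n = ((ℝ ∙ n).measurableEquivProd y).symm ∘
      Prod.map (LinearIsometryEquiv.toSpanUnitSingleton (𝕜 := ℝ) n hn) id := by
    funext q
    simp [cylMap, add_comm, add_left_comm]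
  rw [h3]
  exact h1.comp h2

lemma measurableEmbedding_cylMap {n : E} (hn : ‖n‖ = 1) (y : E) :
    MeasurableEmbedding (cylMap y n) := by
  refine (continuous_cylMap y n).measurableEmbedding fun q q' h => ?_
  have h0 : cylMap y n (q - q') - y = 0 := by
    have : cylMap y n (q - q') - y = cylMap y n q - cylMap y n q' := by
      simp [cylMap, sub_smul]; abel
    rw [this, h, sub_self]
  have h1 := abs_fst_le_norm_cylMap_sub hn y (q - q')
  have h2 := norm_snd_le_norm_cylMap_sub hn y (q - q')
  rw [h0, norm_zero] at h1 h2
  refine Prod.ext ?_ ?_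
  · exact sub_eq_zero.1 (abs_nonpos_iff.1 h1)
  · exact sub_eq_zero.1 (norm_le_zero_iff.1 h2)

lemma exists_cylMap_eq {n : E} (hn : ‖n‖ = 1) (y z : E) : ∃ q, cylMap y n q = z := by
  let e := (ℝ ∙ n).measurableEquivProd y
  refine ⟨((LinearIsometryEquiv.toSpanUnitSingleton (𝕜 := ℝ) n hn).symm (e z).1, (e z).2), ?_⟩
  have h := e.symm_apply_apply z
  rw [Submodule.measurableEquivProd_symm_apply] at h
  conv_rhs => rw [← h]
  have h2 : ((LinearIsometryEquiv.toSpanUnitSingleton (𝕜 := ℝ) n hn).symm (e z).1) • n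
      = ((e z).1 : E) := by
    have := (LinearIsometryEquiv.toSpanUnitSingleton (𝕜 := ℝ) n hn).apply_symm_apply (e z).1
    conv_rhs => rw [← this]
    rw [coe_toSpanUnitSingleton]
  rw [cylMap, h2, vadd_eq_add]
  abel

end Chart

/-! ### The boundary as a Lipschitz graph, and the divergence theorem up to `ε` -/

namespace HalfSpaceChart

section Graph

variable {E : Type*} [NormedAddCommGroup E] [InnerProductSpace ℝ E]
  {D : Set E} {y n : E} {ε r : ℝ} {ψ : E → ℝ}

lemma cylMap_mem_ball (H : HalfSpaceChart D y n ε r ψ) {t : ℝ} {p : (ℝ ∙ n)ᗮ}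
    (ht : |t| ≤ r / 2) (hp : ‖p‖ < r / 2) : cylMap y n (t, p) ∈ ball y r := by
  rw [mem_ball, dist_eq_norm]
  have := norm_cylMap_sub_le H.norm_eq_one y (t, p)
  simp only at this
  linarith

lemma strictMono_cylMap (H : HalfSpaceChart D y n ε r ψ) {s t : ℝ} {p : (ℝ ∙ n)ᗮ}
    (hs : |s| ≤ r / 2) (ht : |t| ≤ r / 2) (hp : ‖p‖ < r / 2) (hst : s < t) :
    ψ (cylMap y n (s, p)) < ψ (cylMap y n (t, p)) := by
  have h1 := H.le_add (H.cylMap_mem_ball hs hp) (H.cylMap_mem_ball ht hp)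
  have h2 : cylMap y n (s, p) - cylMap y n (t, p) = (s - t) • n := by
    simp [cylMap, sub_smul]
  rw [h2, real_inner_smul_right, H.inner_self, norm_smul, H.norm_eq_one, Real.norm_eq_abs,
    abs_of_neg (by linarith)] at h1
  nlinarith [H.eps_le]

/-- The zero set of the defining function is a graph over the tangent hyperplane. -/
lemma exists_graph (H : HalfSpaceChart D y n ε r ψ) :
    ∃ h : (ℝ ∙ n)ᗮ → ℝ, (∀ p, ‖p‖ < r / 2 → |h p| < r / 2 ∧ ψ (cylMap y n (h p, p)) = 0 ∧
      ∀ t, |t| < r / 2 → ((cylMap y n (t, p) ∈ D ↔ t ≤ h p) ∧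
        (cylMap y n (t, p) ∈ frontier D ↔ t = h p))) ∧
      ∀ p q, ‖p‖ < r / 2 → ‖q‖ < r / 2 → |h p - h q| ≤ 2 * ε * ‖p - q‖ := by
  have hr := H.radius_pos
  have hδ : |r / 2| ≤ r / 2 := (abs_of_pos (half_pos hr)).le
  have hδ' : |-(r / 2)| ≤ r / 2 := by rwa [abs_neg]
  have hex : ∀ p : (ℝ ∙ n)ᗮ, ∃ t, ‖p‖ < r / 2 → |t| < r / 2 ∧ ψ (cylMap y n (t, p)) = 0 := by
    intro p
    by_cases hp : ‖p‖ < r / 2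
    swap
    · exact ⟨0, fun h => absurd h hp⟩
    have hend : ∀ t : ℝ, |t| ≤ r / 2 → |ψ (cylMap y n (t, p)) - t| ≤ ε * (|t| + ‖p‖) := by
      intro t ht
      have h1 := H.approx _ (H.cylMap_mem_ball ht hp) y (mem_ball_self hr)
      have h2 : ⟪n, cylMap y n (t, p) - y⟫ = t := by
        have : cylMap y n (t, p) - y = t • n + p := by simp [cylMap, add_assoc]
        rw [this, inner_add_right, real_inner_smul_right, H.inner_self, inner_orthogonal_span]
        ring
      rw [h2, H.base, sub_zero] at h1
      exact h1.trans (mul_le_mul_of_nonneg_left (norm_cylMap_sub_le H.norm_eq_one y (t, p))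
        H.eps_pos.le)
    -- The chart error at the ends `t = ±r/2` is smaller than `r/2`, so `ψ` changes sign on the
    -- segment.
    have hlt : ε * (r / 2 + ‖p‖) < r / 2 := by nlinarith [H.eps_le, H.eps_pos]
    have hpos : 0 < ψ (cylMap y n (r / 2, p)) := by
      have := abs_le.1 (hend _ hδ)
      rw [abs_of_pos (half_pos hr)] at this
      linarith [this.1]
    have hneg : ψ (cylMap y n (-(r / 2), p)) < 0 := by
      have := abs_le.1 (hend _ hδ')
      rw [abs_neg, abs_of_pos (half_pos hr)] at this
      linarith [this.2]
    have hcont : ContinuousOn (fun t => ψ (cylMap y n (t, p))) (Icc (-(r / 2)) (r / 2)) := by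
      refine H.continuousOn.comp
        ((continuous_cylMap y n).comp (Continuous.prodMk_left p)).continuousOn ?_
      exact fun t ht => H.cylMap_mem_ball (abs_le.2 ht) hp
    obtain ⟨t, ht, ht0⟩ := intermediate_value_Ioo (by linarith) hcont ⟨hneg, hpos⟩
    exact ⟨t, fun _ => ⟨abs_lt.2 ht, ht0⟩⟩
  choose h hh using hex
  refine ⟨h, fun p hp => ⟨(hh p hp).1, (hh p hp).2, fun t ht => ?_⟩, fun p q hp hq => ?_⟩
  · have hb := H.cylMap_mem_ball ht.le hp
    rw [H.mem_iff _ hb, H.mem_frontier_iff hb]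
    obtain ⟨h1, h2⟩ := hh p hp
    rcases lt_trichotomy t (h p) with hlt | heq | hgt
    · have := H.strictMono_cylMap ht.le h1.le hp hlt
      rw [h2] at this
      exact ⟨iff_of_true this.le hlt.le, iff_of_false this.ne hlt.ne⟩
    · rw [heq, h2]
      simp
    · have := H.strictMono_cylMap h1.le ht.le hp hgt
      rw [h2] at this
      exact ⟨iff_of_false (not_le.2 this) (not_le.2 hgt), iff_of_false this.ne' hgt.ne'⟩
  · obtain ⟨hp1, hp2⟩ := hh p hp
    obtain ⟨hq1, hq2⟩ := hh q hq
    have h1 := H.approx _ (H.cylMap_mem_ball hp1.le hp) _ (H.cylMap_mem_ball hq1.le hq)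
    have h2 : cylMap y n (h p, p) - cylMap y n (h q, q)
        = cylMap y n (h p - h q, p - q) - y := by
      simp [cylMap, sub_smul]; abel
    have h3 : ⟪n, cylMap y n (h p, p) - cylMap y n (h q, q)⟫ = h p - h q := by
      have : cylMap y n (h p, p) - cylMap y n (h q, q)
          = (h p - h q) • n + ((p - q : (ℝ ∙ n)ᗮ) : E) := by
        simp [cylMap, sub_smul]; abel
      rw [this, inner_add_right, real_inner_smul_right, H.inner_self, inner_orthogonal_span]
      ring
    rw [h3, hp2, hq2, sub_zero, zero_sub, abs_neg, h2] at h1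
    have h4 := norm_cylMap_sub_le H.norm_eq_one y (h p - h q, p - q)
    simp only at h4
    have h5 := H.eps_le
    have h6 := H.eps_pos
    -- Absorbing `ε|h p - h q|` on the left gives the Lipschitz constant `ε / (1 - ε) ≤ 2ε`.
    have h7 : |h p - h q| ≤ ε * (|h p - h q| + ‖p - q‖) :=
      h1.trans (mul_le_mul_of_nonneg_left h4 h6.le)
    have h8 := abs_nonneg (h p - h q)
    nlinarith [norm_nonneg (p - q)]

end Graph

variable {E : Type*} [NormedAddCommGroup E] [InnerProductSpace ℝ E] [FiniteDimensional ℝ E]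
  [MeasurableSpace E] [BorelSpace E] {D : Set E} {y n : E} {ε r : ℝ} {ψ : E → ℝ}

/-- By Fubini along lines parallel to `n`: each line meets `D` within the chart in `t ≤ h p`, and
the fundamental theorem of calculus leaves the value of `g` on the graph. -/
lemma setIntegral_fderiv_normal (H : HalfSpaceChart D y n ε r ψ)
    (hD : NullMeasurableSet D) {g : E → ℝ} (hg : ContDiff ℝ 1 g)
    (hc : HasCompactSupport g) (hsupp : tsupport g ⊆ ball y (r / 2)) {h : (ℝ ∙ n)ᗮ → ℝ}
    (hh : ∀ p, ‖p‖ < r / 2 → |h p| < r / 2 ∧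
      ∀ t, |t| < r / 2 → (cylMap y n (t, p) ∈ D ↔ t ≤ h p)) :
    ∫ z in D, fderiv ℝ g z n = ∫ p in ball (0 : (ℝ ∙ n)ᗮ) (r / 2), g (cylMap y n (h p, p)) := by
  have hn := H.norm_eq_one
  have hmp := measurePreserving_cylMap hn y
  have hemb := measurableEmbedding_cylMap hn y
  have hint : Integrable (D.indicator fun z => fderiv ℝ g z n) :=
    (integrable_fderiv_apply hg hc n).indicator₀ hD
  have hint' : Integrable (fun q => D.indicator (fun z => fderiv ℝ g z n) (cylMap y n q))
      (volume.prod volume) := (hmp.integrable_comp_emb hemb).2 hint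
  rw [← integral_indicator₀ hD, ← hmp.integral_comp hemb, Measure.volume_eq_prod,
    integral_prod_symm _ hint',
    ← integral_indicator measurableSet_ball]
  congr 1
  ext1 p
  have hzero : ∀ t : ℝ, (r / 2 ≤ |t| ∨ r / 2 ≤ ‖p‖) → cylMap y n (t, p) ∉ tsupport g := by
    intro t ht hmem
    have h1 := hsupp hmem
    rw [mem_ball, dist_eq_norm] at h1
    have h2 := abs_fst_le_norm_cylMap_sub hn y (t, p)
    have h3 := norm_snd_le_norm_cylMap_sub hn y (t, p)
    simp only at h2 h3
    rcases ht with ht | ht <;> linarith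
  by_cases hp : ‖p‖ < r / 2
  swap
  · rw [indicator_of_notMem (by simpa using hp)]
    convert integral_zero ℝ ℝ with t
    by_cases hm : cylMap y n (t, p) ∈ D
    · rw [indicator_of_mem hm, fderiv_apply_eq_zero_of_notMem_tsupport
        (hzero t (Or.inr (not_lt.1 hp)))]
    · rw [indicator_of_notMem hm]
  rw [indicator_of_mem (by simpa using hp)]
  have hline : ∀ t, cylMap y n (t, p) = (y + p) + t • n := fun t => by simp [cylMap]; abel
  have hder : ∀ t, HasDerivAt (fun t => g (cylMap y n (t, p)))
      (fderiv ℝ g (cylMap y n (t, p)) n) t := by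
    intro t
    simp only [hline]
    exact hasDerivAt_line hg _ _ _
  have hcs : HasCompactSupport fun t => g (cylMap y n (t, p)) := by
    refine HasCompactSupport.of_support_subset_isCompact
      (isCompact_Icc (a := -(r / 2)) (b := r / 2)) fun t ht => ?_
    by_contra hcon
    refine ht (image_eq_zero_of_notMem_tsupport (hzero t (Or.inl ?_)))
    by_contra hlt
    exact hcon (abs_le.1 (not_le.1 hlt).le)
  have hcd : ContDiff ℝ 1 fun t => g (cylMap y n (t, p)) := by
    simp only [hline]
    exact hg.comp (by fun_prop)
  rw [← hcs.integral_Iic_deriv_eq hcd (h p), ← integral_indicator measurableSet_Iic]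
  classical
  congr 1
  ext1 t
  rw [(indicator_apply (Iic (h p)) _ t), (hder t).deriv, indicator_apply]
  by_cases ht : |t| < r / 2
  · simp only [((hh p hp).2 t ht), mem_Iic]
  · rw [fderiv_apply_eq_zero_of_notMem_tsupport (hzero t (Or.inl (not_lt.1 ht)))]
    simp

lemma euclideanHausdorffMeasure_orthogonal (H : HalfSpaceChart D y n ε r ψ) :
    (μHE[Module.finrank ℝ E - 1] : Measure (ℝ ∙ n)ᗮ) = volume := by
  have hn : n ≠ 0 := by
    intro h
    have := H.norm_eq_one
    simp [h] at this
  have h1 := (ℝ ∙ n).finrank_add_finrank_orthogonal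
  rw [finrank_span_singleton hn] at h1
  have h2 : Module.finrank ℝ E - 1 = Module.finrank ℝ (ℝ ∙ n)ᗮ := by omega
  rw [h2, InnerProductSpace.euclideanHausdorffMeasure_eq_volume]

/-- In a chart the surface measure of the frontier is close to the Lebesgue measure of the
projection to the tangent hyperplane. -/
lemma graph_measure_le (H : HalfSpaceChart D y n ε r ψ) {h : (ℝ ∙ n)ᗮ → ℝ}
    (hh : ∀ p, ‖p‖ < r / 2 → |h p| < r / 2 ∧
      ∀ t, |t| < r / 2 → (cylMap y n (t, p) ∈ frontier D ↔ t = h p))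
    (hl : ∀ p q, ‖p‖ < r / 2 → ‖q‖ < r / 2 → |h p - h q| ≤ 2 * ε * ‖p - q‖) :
    AEMeasurable (fun p => cylMap y n (h p, p))
      (volume.restrict (ball (0 : (ℝ ∙ n)ᗮ) (r / 2))) ∧
    (volume.restrict (ball (0 : (ℝ ∙ n)ᗮ) (r / 2))).map (fun p => cylMap y n (h p, p)) ≤
      (μHE[Module.finrank ℝ E - 1] : Measure E).restrict (frontier D) ∧
    ((μHE[Module.finrank ℝ E - 1] : Measure E).restrict (frontier D)).restrict (ball y (r / 2)) ≤
      ENNReal.ofReal ((1 + 2 * ε) ^ (Module.finrank ℝ E - 1)) •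
        (volume.restrict (ball (0 : (ℝ ∙ n)ᗮ) (r / 2))).map
          (fun p => cylMap y n (h p, p)) := by
  set k := Module.finrank ℝ E - 1
  set γ : (ℝ ∙ n)ᗮ → E := fun p => cylMap y n (h p, p) with hγ
  set B := ball (0 : (ℝ ∙ n)ᗮ) (r / 2)
  have hn := H.norm_eq_one
  have hε := H.eps_pos
  have hB : ∀ {p}, p ∈ B → ‖p‖ < r / 2 := fun hp => by simpa [B] using hp
  have hsub : ∀ p q, γ p - γ q = cylMap y n (h p - h q, p - q) - y := fun p q => by
    simp [hγ, cylMap, sub_smul]; abel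
  have hlip : LipschitzOnWith (1 + 2 * ε).toNNReal γ B := by
    refine LipschitzOnWith.of_dist_le_mul fun p hp q hq => ?_
    rw [dist_eq_norm, dist_eq_norm, hsub, Real.coe_toNNReal _ (by positivity)]
    have h1 := norm_cylMap_sub_le hn y (h p - h q, p - q)
    have h2 := hl p q (hB hp) (hB hq)
    simp only at h1
    linarith
  have hmeas : AEMeasurable γ (volume.restrict B) :=
    hlip.continuousOn.aemeasurable measurableSet_ball
  -- The orthogonal projection to the hyperplane is 1-Lipschitz and inverts `γ`, so `γ` cannot
  -- decrease the measure.
  have hanti : ∀ s ⊆ B, (volume : Measure (ℝ ∙ n)ᗮ) s ≤ (μHE[k] : Measure E) (γ '' s) := by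
    intro s hs
    rw [← H.euclideanHausdorffMeasure_orthogonal]
    let π : E → (ℝ ∙ n)ᗮ := fun z => (ℝ ∙ n)ᗮ.orthogonalProjectionOnto (z - y)
    have hπ : LipschitzWith 1 π := by
      refine LipschitzWith.of_dist_le_mul fun z w => ?_
      have := (ℝ ∙ n)ᗮ.lipschitzWith_orthogonalProjectionOnto.dist_le_mul (z - y) (w - y)
      simpa [π] using this
    have hπγ : ∀ p, π (γ p) = p := by
      intro p
      have h1 : γ p - y = h p • n + p := by simp [hγ, cylMap, add_assoc]
      have h2 : (ℝ ∙ n)ᗮ.orthogonalProjectionOnto n = 0 :=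
        Submodule.orthogonalProjectionOnto_eq_zero_iff.2
          (Submodule.le_orthogonal_orthogonal _ (Submodule.mem_span_singleton_self n))
      simp only [π]
      rw [h1, map_add, map_smul, h2, smul_zero, zero_add,
        Submodule.orthogonalProjectionOnto_mem_subspace_eq_self]
    have := (hπ.lipschitzOnWith (s := γ '' s)).euclideanHausdorffMeasure_image_le k
    rw [image_image] at this
    simpa [hπγ] using this
  refine ⟨hmeas, ?_, ?_⟩
  · refine Measure.le_iff.2 fun A hA => ?_
    rw [Measure.map_apply_of_aemeasurable hmeas hA, Measure.restrict_apply' measurableSet_ball,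
      Measure.restrict_apply hA]
    refine (hanti _ inter_subset_right).trans (measure_mono ?_)
    rintro _ ⟨p, ⟨hp, hpB⟩, rfl⟩
    obtain ⟨h1, h2⟩ := hh p (hB hpB)
    exact ⟨hp, (h2 _ h1).2 rfl⟩
  · refine Measure.le_iff.2 fun A hA => ?_
    rw [Measure.smul_apply, Measure.map_apply_of_aemeasurable hmeas hA,
      Measure.restrict_apply' measurableSet_ball, Measure.restrict_apply' measurableSet_ball,
      Measure.restrict_apply (hA.inter measurableSet_ball), smul_eq_mul,
      ENNReal.ofReal_pow (by positivity)]
    have h1 := (hlip.mono (inter_subset_right (s := γ ⁻¹' A))).euclideanHausdorffMeasure_image_le k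
    rw [H.euclideanHausdorffMeasure_orthogonal] at h1
    refine (measure_mono ?_).trans h1
    rintro z ⟨⟨hzA, hzb⟩, hzf⟩
    obtain ⟨⟨t, p⟩, rfl⟩ := exists_cylMap_eq hn y z
    rw [mem_ball, dist_eq_norm] at hzb
    have ht : |t| < r / 2 := (abs_fst_le_norm_cylMap_sub hn y (t, p)).trans_lt hzb
    have hp : ‖p‖ < r / 2 := (norm_snd_le_norm_cylMap_sub hn y (t, p)).trans_lt hzb
    have hth : t = h p := ((hh p hp).2 t ht).1 hzf
    subst hth
    exact ⟨p, ⟨hzA, by simpa [B] using hp⟩, rfl⟩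

/-- The divergence theorem in a chart, up to a small relative error. -/
lemma abs_setIntegral_fderiv_sub_le (H : HalfSpaceChart D y n ε r ψ)
    (hD : NullMeasurableSet D) (hfin : volume D ≠ ⊤)
    (hσ : (μHE[Module.finrank ℝ E - 1] : Measure E) (frontier D) ≠ ⊤) {g : E → ℝ}
    (hg : ContDiff ℝ 1 g) (hc : HasCompactSupport g) (hsupp : tsupport g ⊆ ball y (r / 2))
    (h0 : ∀ z, 0 ≤ g z) (v : E) :
    |(∫ z in D, fderiv ℝ g z v) - ⟪n, v⟫ * ∫ z in frontier D, g z ∂μHE[Module.finrank ℝ E - 1]|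
      ≤ (((1 + 2 * ε) ^ (Module.finrank ℝ E - 1) - 1) + 2 * ε) * ‖v‖ *
        ∫ z in frontier D, g z ∂μHE[Module.finrank ℝ E - 1] := by
  obtain ⟨h, hh, hl⟩ := H.exists_graph
  obtain ⟨hmeas, hle1, hle2⟩ := H.graph_measure_le (h := h)
    (fun p hp => ⟨(hh p hp).1, fun t ht => ((hh p hp).2.2 t ht).2⟩) hl
  have hA := H.setIntegral_fderiv_normal hD hg hc hsupp (h := h)
    (fun p hp => ⟨(hh p hp).1, fun t ht => ((hh p hp).2.2 t ht).1⟩)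
  have hε := H.eps_pos
  set σ : Measure E := (μHE[Module.finrank ℝ E - 1] : Measure E).restrict (frontier D) with hσdef
  have : IsFiniteMeasure σ := ⟨by rw [hσdef, Measure.restrict_apply_univ]; exact hσ.lt_top⟩
  have hgi : ∀ (μ : Measure E) [IsFiniteMeasure μ], Integrable g μ := fun μ _ =>
    hg.continuous.integrable_of_hasCompactSupport hc
  set S := ∫ z, g z ∂σ with hS
  set A := ∫ z in D, fderiv ℝ g z n with hAdef
  set κ := (1 + 2 * ε) ^ (Module.finrank ℝ E - 1) with hκ
  have hκ1 : 1 ≤ κ := one_le_pow₀ (by linarith)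
  rw [← integral_map (f := g) hmeas hg.continuous.aestronglyMeasurable] at hA
  set μ := (volume.restrict (ball (0 : (ℝ ∙ n)ᗮ) (r / 2))).map fun p => cylMap y n (h p, p)
  have : IsFiniteMeasure μ := isFiniteMeasure_of_le σ hle1
  have hA0 : 0 ≤ A := hA ▸ integral_nonneg h0
  have hAS : A ≤ S := by
    rw [hA]
    exact integral_mono_measure hle1 (ae_of_all _ h0) (hgi σ)
  have hSA : S ≤ κ * A := by
    have h1 : S = ∫ z in ball y (r / 2), g z ∂σ := by
      rw [setIntegral_eq_integral_of_forall_compl_eq_zero]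
      exact fun z hz => image_eq_zero_of_notMem_tsupport fun hz' => hz (hsupp hz')
    have h2 := integral_mono_measure hle2 (ae_of_all _ h0)
      ((hgi μ).smul_measure ENNReal.ofReal_ne_top)
    rwa [integral_smul_measure, ← h1, ← hA, ENNReal.toReal_ofReal (by positivity),
      smul_eq_mul] at h2
  -- Normal and tangential parts: `A ≤ S ≤ κA` controls the first, the cone estimate the second.
  set w := v - ⟪n, v⟫ • n with hw
  have hnw : ⟪n, w⟫ = 0 := by
    rw [hw, inner_sub_right, real_inner_smul_right, H.inner_self]; ring
  have hv : v = ⟪n, v⟫ • n + w := by simp [hw]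
  have hc' : |⟪n, v⟫| ≤ ‖v‖ := by
    simpa [H.norm_eq_one] using abs_real_inner_le_norm n v
  have hwv : ‖w‖ ≤ ‖v‖ := by
    refine abs_le_of_sq_le_sq' ?_ (norm_nonneg _) |>.2
    have : ‖v‖ ^ 2 = ⟪n, v⟫ ^ 2 + ‖w‖ ^ 2 := by
      conv_lhs => rw [hv]
      rw [norm_add_sq_real, real_inner_smul_left, hnw, norm_smul, H.norm_eq_one, mul_one,
        Real.norm_eq_abs, sq_abs]
      ring
    nlinarith [sq_nonneg ⟪n, v⟫]
  have hsplit : ∫ z in D, fderiv ℝ g z v = ⟪n, v⟫ * A + ∫ z in D, fderiv ℝ g z w := by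
    have hint := fun v => (integrable_fderiv_apply (μ := volume) hg hc v).integrableOn (s := D)
    rw [hAdef, ← integral_const_mul, ← integral_add ((hint n).const_mul _) (hint w)]
    congr 1
    ext1 z
    conv_lhs => rw [hv]
    simp
  have hBle := H.abs_setIntegral_fderiv_le hD hfin hg hc
    (hsupp.trans (ball_subset_ball (by linarith [H.radius_pos]))) h0 hnw
  have hB' : |∫ z in D, fderiv ℝ g z w| ≤ 2 * ε * ‖v‖ * S := by
    refine hBle.trans ?_
    rw [← hAdef]
    gcongr
  have hcA : |⟪n, v⟫ * A - ⟪n, v⟫ * S| ≤ ‖v‖ * ((κ - 1) * S) := by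
    rw [← mul_sub, abs_mul, abs_of_nonpos (a := A - S) (by linarith)]
    refine mul_le_mul hc' ?_ (by linarith) (norm_nonneg _)
    nlinarith
  rw [hsplit]
  calc |⟪n, v⟫ * A + (∫ z in D, fderiv ℝ g z w) - ⟪n, v⟫ * S|
      = |(⟪n, v⟫ * A - ⟪n, v⟫ * S) + ∫ z in D, fderiv ℝ g z w| := by congr 1; ring
    _ ≤ ‖v‖ * ((κ - 1) * S) + 2 * ε * ‖v‖ * S := (abs_add_le _ _).trans (add_le_add hcA hB')
    _ = (κ - 1 + 2 * ε) * ‖v‖ * S := by ring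

end HalfSpaceChart

/-! ### The divergence theorem away from the singular boundary points -/

section Divergence

variable {d : ℕ} {D : Set (EuclideanSpace ℝ (Fin d))}

local notation "𝔼" => EuclideanSpace ℝ (Fin d)

lemma surfaceMeasure_univ : surfaceMeasure D univ =
    (μHE[d - 1] : Measure 𝔼) (frontier D) := by
  rw [surfaceMeasure, Measure.restrict_apply_univ]

lemma HasPiecewiseC1Boundary.isFiniteMeasure (hD : HasPiecewiseC1Boundary D) :
    IsFiniteMeasure (surfaceMeasure D) := ⟨hD.1⟩

lemma volume_eq_zero_of_euclideanHausdorffMeasure_ne_top (hd : 0 < d) {s : Set 𝔼}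
    (hs : (μHE[d - 1] : Measure 𝔼) s ≠ ⊤) : volume s = 0 := by
  rw [← EuclideanSpace.euclideanHausdorffMeasure_eq_volume]
  exact (Measure.euclideanHausdorffMeasure_zero_or_top (Nat.sub_lt hd one_pos) s).resolve_right hs

lemma HasPiecewiseC1Boundary.volume_frontier (hD : HasPiecewiseC1Boundary D) (hd : 0 < d) :
    volume (frontier D) = 0 :=
  volume_eq_zero_of_euclideanHausdorffMeasure_ne_top hd (surfaceMeasure_univ ▸ hD.1.ne)

/-- The frontier has finite `(d-1)`-dimensional measure, hence zero volume. -/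
lemma HasPiecewiseC1Boundary.nullMeasurableSet (hD : HasPiecewiseC1Boundary D) (hd : 0 < d) :
    NullMeasurableSet D :=
  nullMeasurableSet_of_null_frontier (hD.volume_frontier hd)

lemma integral_surfaceMeasure_eq_zero {f : 𝔼 → ℝ} (h : ∀ z ∈ frontier D, f z = 0) :
    ∫ z, f z ∂surfaceMeasure D = 0 := by
  rw [surfaceMeasure, setIntegral_congr_fun isClosed_frontier.measurableSet h, integral_zero]

lemma integrable_mul_outwardNormal [IsFiniteMeasure (surfaceMeasure D)] {g : 𝔼 → ℝ}
    (hg : Integrable g (surfaceMeasure D)) (v : 𝔼) :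
    Integrable (fun z => g z * ⟪outwardNormal D z, v⟫) (surfaceMeasure D) := by
  refine hg.mul_bdd (c := ‖v‖) ?_ (ae_of_all _ fun z => ?_)
  · exact (measurable_outwardNormal.inner_const).aestronglyMeasurable
  · exact (norm_inner_le_norm _ _).trans
      (mul_le_of_le_one_left (norm_nonneg _) (norm_outwardNormal_le z))

/-- Integration by parts against the constant function 1. -/
lemma integral_fderiv_apply_eq_zero {E : Type*} [NormedAddCommGroup E] [NormedSpace ℝ E]
    [FiniteDimensional ℝ E] [MeasurableSpace E] [BorelSpace E] {μ : Measure E}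
    [μ.IsAddHaarMeasure] {g : E → ℝ} (hg : ContDiff ℝ 1 g)
    (hc : HasCompactSupport g) (v : E) : ∫ z, fderiv ℝ g z v ∂μ = 0 := by
  have h := integral_mul_fderiv_eq_neg_fderiv_mul_of_integrable (𝕜 := ℝ) (μ := μ)
    (f := fun _ : E => (1 : ℝ)) (g := g) (v := v) (by simp)
    (by simpa using integrable_fderiv_apply hg hc v)
    (by simpa using hg.continuous.integrable_of_hasCompactSupport hc)
    (fun z _ => differentiableAt_const _) (fun z _ => hg.differentiable one_ne_zero z)
  simpa using h

/-- The difference of the two sides of the divergence theorem. -/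
def divergenceDefect (D : Set 𝔼) (v : 𝔼) (g : 𝔼 → ℝ) : ℝ :=
  (∫ z in D, fderiv ℝ g z v) - ∫ z, g z * ⟪outwardNormal D z, v⟫ ∂surfaceMeasure D

lemma divergenceDefect_sum [IsFiniteMeasure (surfaceMeasure D)] {ι : Type*} (s : Finset ι)
    (v : 𝔼) {g : ι → 𝔼 → ℝ} (hg : ∀ i ∈ s, ContDiff ℝ 1 (g i))
    (hc : ∀ i ∈ s, HasCompactSupport (g i)) :
    divergenceDefect D v (fun z => ∑ i ∈ s, g i z) = ∑ i ∈ s, divergenceDefect D v (g i) := by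
  simp only [divergenceDefect, Finset.sum_sub_distrib]
  rw [← integral_finsetSum _ fun i hi =>
      (integrable_fderiv_apply (hg i hi) (hc i hi) v).integrableOn,
    ← integral_finsetSum _ fun i hi => integrable_mul_outwardNormal
      ((hg i hi).continuous.integrable_of_hasCompactSupport (hc i hi)) v]
  simp only [Finset.sum_mul]
  congr 2
  ext1 z
  rw [fderiv_fun_sum fun i hi => (hg i hi).differentiable one_ne_zero z]
  simp

/-- Near an interior point the volume term is an integral over the whole space, which vanishes; near
an exterior point both terms vanish trivially. -/
lemma divergenceDefect_eq_zero_of_disjoint_frontier {y : 𝔼} (hy : y ∉ frontier D) (v : 𝔼) :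
    ∃ r > 0, ∀ g : 𝔼 → ℝ, ContDiff ℝ 1 g → HasCompactSupport g → tsupport g ⊆ ball y r →
      divergenceDefect D v g = 0 := by
  have hcases : y ∈ interior D ∨ y ∈ interior Dᶜ := by
    by_contra hcon
    rw [not_or, interior_compl, mem_compl_iff, not_not] at hcon
    exact hy ⟨hcon.2, hcon.1⟩
  rcases hcases with h | h
  · obtain ⟨r, hr, hb⟩ := Metric.isOpen_iff.1 isOpen_interior y h
    refine ⟨r, hr, fun g hg hc hs => ?_⟩
    rw [divergenceDefect, setIntegral_eq_integral_of_forall_compl_eq_zero,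
      integral_fderiv_apply_eq_zero hg hc, integral_surfaceMeasure_eq_zero, sub_zero]
    · intro z hz
      rw [image_eq_zero_of_notMem_tsupport (fun h => hz.2 (hb (hs h))), zero_mul]
    · exact fun z hz => fderiv_apply_eq_zero_of_notMem_tsupport
        (fun h => hz (interior_subset (hb (hs h)))) v
  · obtain ⟨r, hr, hb⟩ := Metric.isOpen_iff.1 isOpen_interior y h
    refine ⟨r, hr, fun g hg hc hs => ?_⟩
    rw [divergenceDefect, integral_surfaceMeasure_eq_zero,
      setIntegral_eq_zero_of_forall_eq_zero, sub_zero]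
    · exact fun z hz => fderiv_apply_eq_zero_of_notMem_tsupport
        (fun h => interior_subset (hb (hs h)) hz) v
    · intro z hz
      rw [← frontier_compl] at hz
      rw [image_eq_zero_of_notMem_tsupport (fun h => hz.2 (hb (hs h))), zero_mul]

lemma exists_small_constant (k : ℕ) {η : ℝ} (hη : 0 < η) :
    ∃ ε : ℝ, 0 < ε ∧ ε ≤ 1 / 4 ∧ ((1 + 2 * ε) ^ k - 1) + 3 * ε ≤ η := by
  have hcont : Continuous fun ε : ℝ => ((1 + 2 * ε) ^ k - 1) + 3 * ε := by fun_prop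
  have h1 : ∀ᶠ ε in 𝓝[>] (0 : ℝ), ((1 + 2 * ε) ^ k - 1) + 3 * ε < η :=
    nhdsWithin_le_nhds ((hcont.tendsto 0).eventually_lt_const (by simpa using hη))
  have h2 : ∀ᶠ ε in 𝓝[>] (0 : ℝ), ε < 1 / 4 :=
    nhdsWithin_le_nhds (eventually_lt_nhds (by norm_num))
  obtain ⟨ε, h3, h4, h5⟩ := (h1.and (h2.and eventually_mem_nhdsWithin)).exists
  exact ⟨ε, h5, h4.le, h3.le⟩

/-- The chart estimate holds with the constant normal `n`; replacing it by the varying normal costs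
another `ε`, whence the `3ε` in `exists_small_constant`. -/
lemma IsOutwardNormal.abs_divergenceDefect_le (hD : HasPiecewiseC1Boundary D)
    (hbdd : Bornology.IsBounded D) (hd : 0 < d) {y n : 𝔼} (hy : IsOutwardNormal D y n) (v : 𝔼)
    {η : ℝ} (hη : 0 < η) :
    ∃ r > 0, ∀ g : 𝔼 → ℝ, ContDiff ℝ 1 g → HasCompactSupport g → tsupport g ⊆ ball y r →
      (∀ z, 0 ≤ g z) →
      |divergenceDefect D v g| ≤ η * ‖v‖ * ∫ z, g z ∂surfaceMeasure D := by
  have hfin := hD.isFiniteMeasure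
  obtain ⟨ε, hε, hε4, hεη⟩ := exists_small_constant (d - 1) hη
  obtain ⟨r, ψ, H⟩ := hy.exists_chart hε hε4
  obtain ⟨s, hs, hnear⟩ := Metric.mem_nhds_iff.1 (hy.eventually_near hε)
  refine ⟨min (r / 2) s, lt_min (half_pos H.radius_pos) hs, fun g hg hc hsupp h0 => ?_⟩
  have hfr : Module.finrank ℝ 𝔼 - 1 = d - 1 := by simp
  have h1 := H.abs_setIntegral_fderiv_sub_le (hD.nullMeasurableSet hd)
    hbdd.measure_lt_top.ne (by rw [hfr, ← surfaceMeasure_univ]; exact hD.1.ne) hg hc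
    (hsupp.trans (ball_subset_ball (min_le_left _ _))) h0 v
  rw [hfr] at h1
  change |_ - ⟪n, v⟫ * ∫ z, g z ∂surfaceMeasure D| ≤ _ * ∫ z, g z ∂surfaceMeasure D at h1
  have hgi : Integrable g (surfaceMeasure D) := hg.continuous.integrable_of_hasCompactSupport hc
  have h2 : |⟪n, v⟫ * (∫ z, g z ∂surfaceMeasure D) -
      ∫ z, g z * ⟪outwardNormal D z, v⟫ ∂surfaceMeasure D|
      ≤ ε * ‖v‖ * ∫ z, g z ∂surfaceMeasure D := by
    rw [← integral_const_mul, ← integral_const_mul,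
      ← integral_sub (hgi.const_mul _) (integrable_mul_outwardNormal hgi v), ← Real.norm_eq_abs]
    refine norm_integral_le_of_norm_le (hgi.const_mul _) ?_
    refine (ae_restrict_iff' isClosed_frontier.measurableSet).2 (ae_of_all _ fun z hz => ?_)
    by_cases hzs : z ∈ tsupport g
    · have h3 := (hnear (ball_subset_ball (min_le_right _ _) (hsupp hzs)) hz).2
      have h4 : ⟪n, v⟫ * g z - g z * ⟪outwardNormal D z, v⟫
          = g z * ⟪n - outwardNormal D z, v⟫ := by
        rw [inner_sub_left]; ring
      rw [h4, norm_mul, Real.norm_of_nonneg (h0 z), mul_comm]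
      refine mul_le_mul_of_nonneg_right ?_ (h0 z)
      refine (norm_inner_le_norm _ _).trans (mul_le_mul_of_nonneg_right ?_ (norm_nonneg _))
      rwa [norm_sub_rev]
    · simp [image_eq_zero_of_notMem_tsupport hzs]
  have hS : 0 ≤ ∫ z, g z ∂surfaceMeasure D := integral_nonneg h0
  calc |divergenceDefect D v g|
      ≤ _ := abs_sub_le _ (⟪n, v⟫ * ∫ z, g z ∂surfaceMeasure D) _
    _ ≤ _ := add_le_add h1 h2
    _ = (((1 + 2 * ε) ^ (d - 1) - 1) + 3 * ε) * (‖v‖ * ∫ z, g z ∂surfaceMeasure D) := by ring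
    _ ≤ η * (‖v‖ * ∫ z, g z ∂surfaceMeasure D) := by gcongr
    _ = _ := by ring

/-- A finite smooth partition of unity on a compact set. -/
lemma exists_finite_partition {K : Set 𝔼} (hK : IsCompact K) (r : 𝔼 → ℝ)
    (hr : ∀ y ∈ K, 0 < r y) :
    ∃ (s : Finset 𝔼) (χ : 𝔼 → 𝔼 → ℝ), (∀ y ∈ s, y ∈ K) ∧ (∀ y ∈ s, ContDiff ℝ 1 (χ y)) ∧
      (∀ y ∈ s, tsupport (χ y) ⊆ ball y (r y)) ∧ (∀ y ∈ s, ∀ z, 0 ≤ χ y z) ∧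
      ∀ z ∈ K, ∑ y ∈ s, χ y z = 1 := by
  classical
  obtain ⟨s, hsK, hs⟩ := hK.elim_nhds_subcover (fun y => ball y (r y))
    fun y hy => ball_mem_nhds y (hr y hy)
  obtain ⟨f, hf⟩ := SmoothPartitionOfUnity.exists_isSubordinate (modelWithCornersSelf ℝ 𝔼)
    hK.isClosed (fun y : s => ball (y : 𝔼) (r y)) (fun y => isOpen_ball)
    (fun z hz => by simpa using hs hz)
  let χ : 𝔼 → 𝔼 → ℝ := fun y => if hy : y ∈ s then f ⟨y, hy⟩ else 0
  have hχ : ∀ y (hy : y ∈ s), χ y = f ⟨y, hy⟩ := fun y hy => dif_pos hy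
  refine ⟨s, χ, hsK, fun y hy => ?_, fun y hy => ?_,
    fun y hy z => ?_, fun z hz => ?_⟩
  · rw [hχ y hy]
    exact (f ⟨y, hy⟩).contMDiff.contDiff.of_le (by exact_mod_cast le_top)
  · rw [hχ y hy]
    exact hf ⟨y, hy⟩
  · rw [hχ y hy]
    exact f.nonneg _ z
  · have h1 := f.sum_eq_one hz
    rw [finsum_eq_sum_of_fintype] at h1
    rw [← h1, ← Finset.sum_coe_sort s]
    refine Finset.sum_congr rfl fun y _ => ?_
    rw [hχ y y.2]

/-- Nonnegativity matters because the local errors are proportional to `∫ χ g dσ`. These sum to `∫ g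
dσ` over a partition of unity, however many pieces it has. -/
lemma divergenceDefect_eq_zero_of_nonneg (hD : HasPiecewiseC1Boundary D)
    (hbdd : Bornology.IsBounded D) (hd : 0 < d) (v : 𝔼) {g : 𝔼 → ℝ} (hg : ContDiff ℝ 1 g)
    (hc : HasCompactSupport g) (h0 : ∀ z, 0 ≤ g z)
    (hreg : ∀ y ∈ tsupport g, y ∈ frontier D → y ∈ regularBoundary D) :
    divergenceDefect D v g = 0 := by
  have hfin := hD.isFiniteMeasure
  set S := ∫ z, g z ∂surfaceMeasure D
  have key : ∀ η > 0, |divergenceDefect D v g| ≤ η * (‖v‖ * S) := by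
    intro η hη
    have hloc : ∀ y : 𝔼, ∃ r : ℝ, y ∈ tsupport g → 0 < r ∧
        ∀ g : 𝔼 → ℝ, ContDiff ℝ 1 g → HasCompactSupport g → tsupport g ⊆ ball y r →
        (∀ z, 0 ≤ g z) →
        |divergenceDefect D v g| ≤ η * ‖v‖ * ∫ z, g z ∂surfaceMeasure D := by
      intro y
      by_cases hy : y ∈ tsupport g
      swap
      · exact ⟨0, fun h => absurd h hy⟩
      by_cases hyf : y ∈ frontier D
      · obtain ⟨n, hn⟩ := hreg y hy hyf
        obtain ⟨r, hr, h⟩ := hn.abs_divergenceDefect_le hD hbdd hd v hη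
        exact ⟨r, fun _ => ⟨hr, h⟩⟩
      · obtain ⟨r, hr, h⟩ := divergenceDefect_eq_zero_of_disjoint_frontier hyf v
        refine ⟨r, fun _ => ⟨hr, fun g hg hc hs h0 => ?_⟩⟩
        rw [h g hg hc hs, abs_zero]
        have : 0 ≤ ∫ z, g z ∂surfaceMeasure D := integral_nonneg h0
        positivity
    choose r hr using hloc
    obtain ⟨s, χ, hsK, hχ, hχs, hχ0, hχ1⟩ :=
      exists_finite_partition hc.isCompact r fun y hy => (hr y hy).1
    have hsum : g = fun z => ∑ y ∈ s, χ y z * g z := by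
      ext1 z
      by_cases hz : z ∈ tsupport g
      · rw [← Finset.sum_mul, hχ1 z hz, one_mul]
      · simp [image_eq_zero_of_notMem_tsupport hz]
    have hcd : ∀ y ∈ s, ContDiff ℝ 1 fun z => χ y z * g z := fun y hy => (hχ y hy).mul hg
    have hcc : ∀ y ∈ s, HasCompactSupport fun z => χ y z * g z := fun y hy => hc.mul_left
    have hS : S = ∑ y ∈ s, ∫ z, χ y z * g z ∂surfaceMeasure D := by
      rw [← integral_finsetSum _ fun y hy =>
        (hcd y hy).continuous.integrable_of_hasCompactSupport (hcc y hy)]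
      exact congrArg (fun f : 𝔼 → ℝ => ∫ z, f z ∂surfaceMeasure D) hsum
    rw [hsum, divergenceDefect_sum s v hcd hcc]
    refine (Finset.abs_sum_le_sum_abs _ _).trans ?_
    rw [hS, Finset.mul_sum, Finset.mul_sum]
    refine Finset.sum_le_sum fun y hy => ?_
    rw [← mul_assoc]
    refine (hr y (hsK y hy)).2 _ (hcd y hy) (hcc y hy) ?_ fun z => mul_nonneg (hχ0 y hy z) (h0 z)
    exact (tsupport_mul_subset_left).trans (hχs y hy)
  have hC : 0 ≤ ‖v‖ * S := mul_nonneg (norm_nonneg _) (integral_nonneg h0)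
  have : |divergenceDefect D v g| ≤ 0 := by
    refine le_of_forall_pos_le_add fun δ hδ => ?_
    refine (key (δ / (‖v‖ * S + 1)) (by positivity)).trans ?_
    rw [zero_add, div_mul_eq_mul_div, div_le_iff₀ (by positivity)]
    nlinarith
  exact abs_nonpos_iff.1 this

end Divergence

/-! ### Ball covers and cutoffs for a null set -/

/-- A compact set of vanishing Hausdorff measure is covered by finitely many small balls centred
on it, with small total content. -/
lemma exists_finite_ball_cover {X : Type*} [MetricSpace X] [MeasurableSpace X] [BorelSpace X] [Nonempty X]
    {N : Set X} (hN : IsCompact N) {k : ℕ} (hk : 0 < k) (h0 : (μHE[k] : Measure X) N = 0)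
    {ε : ℝ} (hε : 0 < ε) :
    ∃ (F : Finset ℕ) (c : ℕ → X) (ρ : ℕ → ℝ), (∀ i ∈ F, c i ∈ N ∧ 0 < ρ i ∧ ρ i < ε) ∧
      N ⊆ ⋃ i ∈ F, ball (c i) (ρ i) ∧ ∑ i ∈ F, ρ i ^ k < ε := by
  classical
  rcases N.eq_empty_or_nonempty with rfl | ⟨x₀, hx₀⟩
  · exact ⟨∅, fun _ => Classical.arbitrary X, fun _ => 0, by simp, by simp, by simpa⟩
  have hH : (μH[(k : ℝ)] : Measure X) N = 0 := by
    rw [Measure.euclideanHausdorffMeasure_def, Measure.smul_apply, ENNReal.smul_def, smul_eq_mul,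
      mul_eq_zero] at h0
    exact h0.resolve_left (by
      simpa using Measure.addHaarScalarFactor_volume_hausdorffMeasure_ne_zero k)
  rw [Measure.hausdorffMeasure_apply] at hH
  have hr : 0 < ENNReal.ofReal (ε / 2) := ENNReal.ofReal_pos.2 (half_pos hε)
  -- The diameters and the paddings `η` contribute at most `e` each, and `(a + b)^k ≤ 2^k (a^k +
  -- b^k)`, so the total is at most `ε / 2`.
  set e := ε / (4 * 2 ^ k) with he
  have hepos : 0 < e := by positivity
  have hinf := (ENNReal.iSup_eq_zero.1 (ENNReal.iSup_eq_zero.1 hH (ENNReal.ofReal (ε / 2)))) hr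
  have hlt := hinf.trans_lt (ENNReal.ofReal_pos.2 hepos)
  simp only [iInf_lt_iff] at hlt
  obtain ⟨t, htN, htd, hsum⟩ := hlt
  obtain ⟨η, hη0, hηs⟩ := ENNReal.exists_pos_sum_of_countable
    (ENNReal.ofReal_pos.2 (lt_min hepos (lt_min one_pos (half_pos hε)))).ne' ℕ
  have hηlt : ∀ i, (η i : ℝ) < min e (min 1 (ε / 2)) := fun i => by
    have := (ENNReal.le_tsum i).trans_lt hηs
    rw [← ENNReal.ofReal_coe_nnreal, ENNReal.ofReal_lt_ofReal_iff'] at this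
    exact this.1
  -- The paddings make the covering balls open; this bound uses `0 < k` and `η i < 1`.
  have hη1 : ∀ i, (η i : ℝ) ^ k ≤ η i := fun i =>
    pow_le_of_le_one (NNReal.coe_nonneg (η i)) ((hηlt i).le.trans ((min_le_right _ _).trans (min_le_left _ _))) hk.ne'
  let c : ℕ → X := fun i => if h : (t i ∩ N).Nonempty then h.some else x₀
  have hc : ∀ i, (t i ∩ N).Nonempty → c i ∈ t i ∩ N := fun i h => by
    simp only [c, dif_pos h]
    exact h.some_mem
  have hcN : ∀ i, c i ∈ N := fun i => by
    by_cases h : (t i ∩ N).Nonempty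
    · exact (hc i h).2
    · simpa only [c, dif_neg h] using hx₀
  let ρ : ℕ → ℝ := fun i => diam (t i) + η i
  have hdne : ∀ i, ediam (t i) ≠ ⊤ := fun i => ((htd i).trans_lt ENNReal.ofReal_lt_top).ne
  have hdiam : ∀ i, diam (t i) ≤ ε / 2 := fun i =>
    ENNReal.toReal_le_of_le_ofReal (half_pos hε).le (htd i)
  have hcover : N ⊆ ⋃ i ∈ {i | (t i ∩ N).Nonempty}, ball (c i) (ρ i) := by
    intro z hz
    obtain ⟨i, hi⟩ := mem_iUnion.1 (htN hz)
    have hne : (t i ∩ N).Nonempty := ⟨z, hi, hz⟩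
    refine mem_iUnion₂.2 ⟨i, hne, ?_⟩
    rw [mem_ball]
    have h1 : dist z (c i) ≤ diam (t i) :=
      dist_le_diam_of_mem (isBounded_iff_ediam_ne_top.2 (hdne i)) hi (hc i hne).1
    have h2 : (0 : ℝ) < η i := hη0 i
    exact h1.trans_lt (by simp only [ρ]; linarith)
  obtain ⟨b, hb, hbfin, hF⟩ := hN.elim_finite_subcover_image (fun i _ => isOpen_ball) hcover
  lift b to Finset ℕ using hbfin with F
  refine ⟨F, c, ρ, fun i _ => ⟨hcN i, ?_, ?_⟩, ?_, ?_⟩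
  · have h2 : (0 : ℝ) < η i := hη0 i
    have := diam_nonneg (s := t i)
    simp only [ρ]; linarith
  · have h1 := (hηlt i).trans_le ((min_le_right _ _).trans (min_le_right _ _))
    simp only [ρ]; linarith [hdiam i]
  · simpa using hF
  · have h1 : ∑ i ∈ F, diam (t i) ^ k ≤ e := by
      rw [← ENNReal.ofReal_le_ofReal_iff hepos.le,
        ENNReal.ofReal_sum_of_nonneg fun i _ => pow_nonneg diam_nonneg k]
      calc ∑ i ∈ F, ENNReal.ofReal (diam (t i) ^ k)
          ≤ ∑ i ∈ F, ⨆ _ : (t i).Nonempty, ediam (t i) ^ (k : ℝ) := by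
            refine Finset.sum_le_sum fun i hi => ?_
            rw [iSup_pos ((hb hi).mono inter_subset_left), ENNReal.ofReal_pow diam_nonneg, diam,
              ENNReal.ofReal_toReal (hdne _), ENNReal.rpow_natCast]
        _ ≤ _ := ENNReal.sum_le_tsum _
        _ ≤ ENNReal.ofReal e := hsum.le
    have h2 : ∑ i ∈ F, (η i : ℝ) ≤ e := by
      rw [← ENNReal.ofReal_le_ofReal_iff hepos.le,
        ENNReal.ofReal_sum_of_nonneg fun i _ => NNReal.coe_nonneg _]
      calc ∑ i ∈ F, ENNReal.ofReal (η i)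
          = ∑ i ∈ F, (η i : ENNReal) := by simp
        _ ≤ _ := ENNReal.sum_le_tsum _
        _ ≤ _ := hηs.le
        _ ≤ ENNReal.ofReal e := ENNReal.ofReal_le_ofReal (min_le_left _ _)
    calc ∑ i ∈ F, ρ i ^ k ≤ ∑ i ∈ F, 2 ^ k * (diam (t i) ^ k + η i) := by
          refine Finset.sum_le_sum fun i _ => ?_
          refine (add_pow_le diam_nonneg (NNReal.coe_nonneg (η i)) k).trans ?_
          have : (2 : ℝ) ^ (k - 1) ≤ 2 ^ k := pow_le_pow_right₀ one_le_two (Nat.sub_le _ _)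
          have h3 := hη1 i
          have h4 : 0 ≤ diam (t i) ^ k := pow_nonneg diam_nonneg k
          have h5 : 0 ≤ (η i : ℝ) ^ k := by positivity
          exact mul_le_mul this (by linarith) (by linarith) (by positivity)
      _ = 2 ^ k * (∑ i ∈ F, diam (t i) ^ k + ∑ i ∈ F, (η i : ℝ)) := by
          rw [← Finset.mul_sum, Finset.sum_add_distrib]
      _ ≤ 2 ^ k * (e + e) := by gcongr
      _ = ε / 2 := by rw [he]; field_simp; ring
      _ < ε := half_lt_self hε

section Cutoff

variable {E : Type*} [NormedAddCommGroup E] [InnerProductSpace ℝ E] [FiniteDimensional ℝ E]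
  [MeasurableSpace E] [BorelSpace E]

/-- The chain rule gives `ρ⁻¹` and the change of variables gives `ρ^d`, so the cost of a bump is of
the order of its `(d-1)`-dimensional content. -/
lemma integral_abs_fderiv_rescale (β : E → ℝ) (c : E) {ρ : ℝ} (hρ : 0 < ρ)
    (hd : 0 < Module.finrank ℝ E) (v : E) :
    ∫ z, |fderiv ℝ (fun z => β (ρ⁻¹ • (z - c))) z v| =
      ρ ^ (Module.finrank ℝ E - 1) * ∫ z, |fderiv ℝ β z v| := by
  have h1 : ∀ z, |fderiv ℝ (fun z => β (ρ⁻¹ • (z - c))) z v|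
      = ρ⁻¹ * |fderiv ℝ β (ρ⁻¹ • (z - c)) v| := fun z => by
    rw [fderiv_comp_sub (f := fun w => β (ρ⁻¹ • w)), fderiv_comp_smul,
      smul_apply, smul_eq_mul, abs_mul, abs_of_pos (inv_pos.2 hρ)]
  simp only [h1]
  rw [integral_sub_right_eq_self (fun z => ρ⁻¹ * |fderiv ℝ β (ρ⁻¹ • z) v|), integral_const_mul,
    Measure.integral_comp_inv_smul volume (fun z => |fderiv ℝ β z v|), smul_eq_mul,
    abs_of_pos (pow_pos hρ _), ← mul_assoc]
  congr 1
  obtain ⟨k, hk⟩ := Nat.exists_eq_succ_of_ne_zero hd.ne'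
  rw [hk, Nat.succ_sub_one, pow_succ]
  field_simp

/-- The cutoff is the product of `1 - b` over bumps `b` equal to 1 on the balls of a fine cover. Its
derivative is at most the sum of those of the bumps, so its `L¹` norm is at most a constant times
the sum of `ρ^(d-1)`. -/
lemma exists_cutoff {N : Set E} (hN : IsCompact N) (hd : 2 ≤ Module.finrank ℝ E)
    (h0 : (μHE[Module.finrank ℝ E - 1] : Measure E) N = 0) (v : E) :
    ∃ χ : ℕ → E → ℝ, (∀ m, ContDiff ℝ 1 (χ m)) ∧ (∀ m z, 0 ≤ χ m z ∧ χ m z ≤ 1) ∧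
      (∀ m, ∀ z ∈ tsupport (χ m), z ∉ N) ∧ (∀ z ∉ N, ∀ᶠ m in atTop, χ m z = 1) ∧
      (∀ m, Integrable fun z => fderiv ℝ (χ m) z v) ∧
      Tendsto (fun m => ∫ z, |fderiv ℝ (χ m) z v|) atTop (𝓝 0) := by
  classical
  set k := Module.finrank ℝ E - 1 with hk
  let β : ContDiffBump (0 : E) := ⟨1, 2, one_pos, one_lt_two⟩
  have hβ : ContDiff ℝ 1 β := β.contDiff
  set K := ∫ z, |fderiv ℝ β z v| with hK
  have hK0 : 0 ≤ K := integral_nonneg fun _ => abs_nonneg _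
  have hpos : ∀ m : ℕ, (0 : ℝ) < 1 / ((m : ℝ) + 1) := fun m => by positivity
  choose F c ρ hF hcov hsum using fun m : ℕ =>
    exists_finite_ball_cover hN (k := k) (by omega) h0 (hpos m)
  let b : ℕ → ℕ → E → ℝ := fun m i z => β ((ρ m i)⁻¹ • (z - c m i))
  have hb : ∀ m i, ContDiff ℝ 1 (b m i) := fun m i => hβ.comp (by fun_prop)
  have hbc : ∀ m, ∀ i ∈ F m, HasCompactSupport (b m i) := fun m i hi => by
    have := β.hasCompactSupport.comp_homeomorph
      ((Homeomorph.subRight (c m i)).trans (Homeomorph.smulOfNeZero (ρ m i)⁻¹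
        (inv_ne_zero (hF m i hi).2.1.ne')))
    exact this
  have hb01 : ∀ m i z, 0 ≤ 1 - b m i z ∧ 1 - b m i z ≤ 1 := fun m i z =>
    ⟨sub_nonneg.2 β.le_one, sub_le_self _ β.nonneg⟩
  have hχcd : ∀ m, ContDiff ℝ 1 fun z => ∏ i ∈ F m, (1 - b m i z) := fun m =>
    contDiff_prod fun i _ => contDiff_const.sub (hb m i)
  have hder : ∀ m z, |fderiv ℝ (fun z => ∏ i ∈ F m, (1 - b m i z)) z v|
      ≤ ∑ i ∈ F m, |fderiv ℝ (b m i) z v| := by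
    intro m z
    rw [fderiv_finsetProd fun i _ =>
      ((contDiff_const.sub (hb m i)).differentiable one_ne_zero) z]
    simp only [sum_apply, smul_apply, smul_eq_mul]
    refine (Finset.abs_sum_le_sum_abs _ _).trans (Finset.sum_le_sum fun i _ => ?_)
    rw [fderiv_const_sub, neg_apply, abs_mul, abs_neg]
    refine mul_le_of_le_one_left (abs_nonneg _) ?_
    rw [abs_of_nonneg (Finset.prod_nonneg fun j _ => (hb01 m j z).1)]
    exact Finset.prod_le_one (fun j _ => (hb01 m j z).1) fun j _ => (hb01 m j z).2
  have hbint : ∀ m, Integrable fun z => ∑ i ∈ F m, |fderiv ℝ (b m i) z v| := fun m =>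
    integrable_finsetSum _ fun i hi => (integrable_fderiv_apply (hb m i) (hbc m i hi) v).abs
  have hint : ∀ m, Integrable fun z => fderiv ℝ (fun z => ∏ i ∈ F m, (1 - b m i z)) z v :=
    fun m => (hbint m).mono' ((hχcd m).continuous_fderiv_apply' v).aestronglyMeasurable
      (ae_of_all _ (hder m))
  have hlim0 : Tendsto (fun m : ℕ => 1 / ((m : ℝ) + 1)) atTop (𝓝 0) :=
    tendsto_one_div_add_atTop_nhds_zero_nat
  refine ⟨fun m z => ∏ i ∈ F m, (1 - b m i z), hχcd, fun m z =>
    ⟨Finset.prod_nonneg fun j _ => (hb01 m j z).1,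
      Finset.prod_le_one (fun j _ => (hb01 m j z).1) fun j _ => (hb01 m j z).2⟩,
    fun m z hz hzN => ?_, fun z hz => ?_, hint, ?_⟩
  · have hopen : IsOpen (⋃ i ∈ F m, ball (c m i) (ρ m i)) :=
      isOpen_biUnion fun i _ => isOpen_ball
    refine notMem_tsupport_iff_eventuallyEq.2 ?_ hz
    filter_upwards [hopen.mem_nhds (hcov m hzN)] with w hw
    obtain ⟨i, hi, hwi⟩ := mem_iUnion₂.1 hw
    refine Finset.prod_eq_zero hi ?_
    have : b m i w = 1 := by
      refine β.one_of_mem_closedBall ?_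
      have hρ := (hF m i hi).2.1
      rw [mem_closedBall, dist_zero_right, norm_smul, Real.norm_of_nonneg (inv_pos.2 hρ).le,
        inv_mul_le_iff₀ hρ, ← dist_eq_norm, mul_one]
      exact (mem_ball.1 hwi).le
    rw [this, sub_self]
  · obtain ⟨δ, hδ, hball⟩ := Metric.isOpen_iff.1 hN.isClosed.isOpen_compl z hz
    -- The bumps live on balls of twice the radius, so radii below `δ / 2` keep them away from `z`.
    filter_upwards [hlim0.eventually_lt_const (half_pos hδ)] with m hm
    refine Finset.prod_eq_one fun i hi => ?_
    obtain ⟨hcN, hρ, hρm⟩ := hF m i hi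
    have hdist : δ ≤ dist (c m i) z := by
      by_contra hlt
      exact hball (mem_ball.2 (not_le.1 hlt)) hcN
    have : b m i z = 0 := by
      refine β.zero_of_le_dist ?_
      change (2 : ℝ) ≤ _
      rw [dist_zero_right, norm_smul, Real.norm_of_nonneg (inv_pos.2 hρ).le,
        le_inv_mul_iff₀ hρ, ← dist_eq_norm, dist_comm]
      linarith
    rw [this, sub_zero]
  · refine squeeze_zero (fun m => integral_nonneg fun _ => abs_nonneg _) (fun m => ?_)
      (by simpa only [zero_mul] using hlim0.mul_const K)
    calc ∫ z, |fderiv ℝ (fun z => ∏ i ∈ F m, (1 - b m i z)) z v|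
        ≤ ∫ z, ∑ i ∈ F m, |fderiv ℝ (b m i) z v| :=
          integral_mono (hint m).abs (hbint m) (hder m)
      _ = ∑ i ∈ F m, ρ m i ^ k * K := by
          rw [integral_finsetSum _ fun i hi =>
            (integrable_fderiv_apply (hb m i) (hbc m i hi) v).abs]
          exact Finset.sum_congr rfl fun i hi =>
            integral_abs_fderiv_rescale β (c m i) (hF m i hi).2.1 (by omega) v
      _ = (∑ i ∈ F m, ρ m i ^ k) * K := by rw [Finset.sum_mul]
      _ ≤ 1 / ((m : ℝ) + 1) * K := by
          gcongr
          exact (hsum m).le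

end Cutoff

/-! ### The divergence theorem with singular boundary points -/

section DivergenceTheorem

variable {d : ℕ} {D : Set (EuclideanSpace ℝ (Fin d))}

local notation "𝔼" => EuclideanSpace ℝ (Fin d)

lemma HasPiecewiseC1Boundary.measure_diff_eq_zero (hD : HasPiecewiseC1Boundary D) :
    (μHE[d - 1] : Measure 𝔼) (frontier D \ regularBoundary D) = 0 := by
  have h := hD.2
  rw [surfaceMeasure, ae_restrict_iff' isClosed_frontier.measurableSet] at h
  refine measure_mono_null (fun z hz => ?_) h
  exact fun h => hz.2 (h hz.1)

/-- The regular case applies to `χ_m g`. In the product rule the term `g ∂χ_m` tends to zero in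
`L¹`, and the others converge by dominated convergence, the singular set being null for both
measures. -/
lemma divergenceDefect_eq_zero_of_nonneg' (hd : 2 ≤ d) (hD : HasPiecewiseC1Boundary D)
    (hbdd : Bornology.IsBounded D) (v : 𝔼) {g : 𝔼 → ℝ} (hg : ContDiff ℝ 1 g)
    (hc : HasCompactSupport g) (h0 : ∀ z, 0 ≤ g z) : divergenceDefect D v g = 0 := by
  have hfin := hD.isFiniteMeasure
  set N := frontier D \ regularBoundary D with hNdef
  have hN0 := hD.measure_diff_eq_zero
  have hNc : IsCompact N := isCompact_of_isClosed_isBounded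
    isClosed_frontier_diff_regularBoundary
    (hbdd.closure.subset (sdiff_subset.trans frontier_subset_closure))
  have hNvol : volume N = 0 :=
    volume_eq_zero_of_euclideanHausdorffMeasure_ne_top (by omega) (by rw [hN0]; simp)
  obtain ⟨χ, hχ, hχ01, hχN, hχ1, hχi, hχlim⟩ :=
    exists_cutoff hNc (by simpa using hd) (by simpa using hN0) v
  have hzero : ∀ m, divergenceDefect D v (fun z => χ m z * g z) = 0 := fun m =>
    divergenceDefect_eq_zero_of_nonneg hD hbdd (by omega) v ((hχ m).mul hg) hc.mul_left
      (fun z => mul_nonneg (hχ01 m z).1 (h0 z)) fun y hy hyf => by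
        by_contra hreg
        exact hχN m y (tsupport_mul_subset_left hy) ⟨hyf, hreg⟩
  have hχnorm : ∀ m z, ‖χ m z‖ ≤ 1 := fun m z => by
    rw [Real.norm_of_nonneg (hχ01 m z).1]; exact (hχ01 m z).2
  obtain ⟨M, hM⟩ := hc.exists_bound_of_continuous hg.continuous
  have hgi : Integrable g (surfaceMeasure D) := hg.continuous.integrable_of_hasCompactSupport hc
  have hfi := (integrable_fderiv_apply (μ := volume) hg hc v).integrableOn (s := D)
  have hL1 : Tendsto (fun m => ∫ z in D, χ m z * fderiv ℝ g z v) atTop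
      (𝓝 (∫ z in D, fderiv ℝ g z v)) := by
    refine tendsto_integral_of_dominated_convergence (fun z => ‖fderiv ℝ g z v‖)
      (fun m => ((hχ m).continuous.mul (hg.continuous_fderiv_apply' v)).aestronglyMeasurable)
      hfi.norm (fun m => ae_of_all _ fun z => ?_) ?_
    · rw [norm_mul]
      exact mul_le_of_le_one_left (norm_nonneg _) (hχnorm m z)
    · refine ae_restrict_of_ae ?_
      filter_upwards [compl_mem_ae_iff.2 hNvol] with z hz
      refine tendsto_const_nhds.congr' ?_
      filter_upwards [hχ1 z hz] with m hm
      rw [hm, one_mul]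
  have hL2 : Tendsto (fun m => ∫ z in D, g z * fderiv ℝ (χ m) z v) atTop (𝓝 0) := by
    refine squeeze_zero_norm (fun m => ?_) (by simpa only [mul_zero] using hχlim.const_mul M)
    rw [← integral_const_mul]
    refine (norm_integral_le_of_norm_le (((hχi m).abs.const_mul M).integrableOn (s := D))
      (ae_of_all _ fun z => ?_)).trans (setIntegral_le_integral ((hχi m).abs.const_mul M)
        (ae_of_all _ fun z => ?_))
    · rw [norm_mul]
      exact mul_le_mul_of_nonneg_right (hM z) (norm_nonneg _)
    · exact mul_nonneg ((norm_nonneg _).trans (hM z)) (abs_nonneg _)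
  have hL3 : Tendsto (fun m => ∫ z, χ m z * g z * ⟪outwardNormal D z, v⟫ ∂surfaceMeasure D) atTop
      (𝓝 (∫ z, g z * ⟪outwardNormal D z, v⟫ ∂surfaceMeasure D)) := by
    have hgv := integrable_mul_outwardNormal hgi v
    simp only [mul_assoc]
    refine tendsto_integral_of_dominated_convergence
      (fun z => ‖g z * ⟪outwardNormal D z, v⟫‖)
      (fun m => (hχ m).continuous.aestronglyMeasurable.mul hgv.aestronglyMeasurable)
      hgv.norm (fun m => ae_of_all _ fun z => ?_) ?_
    · rw [norm_mul]
      exact mul_le_of_le_one_left (norm_nonneg _) (hχnorm m z)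
    · filter_upwards [hD.2] with z hz
      refine tendsto_const_nhds.congr' ?_
      filter_upwards [hχ1 z fun h => h.2 hz] with m hm
      rw [hm, one_mul]
  have hsplit : ∀ m, ∫ z in D, fderiv ℝ (fun z => χ m z * g z) z v
      = (∫ z in D, χ m z * fderiv ℝ g z v) + ∫ z in D, g z * fderiv ℝ (χ m) z v := by
    intro m
    rw [← integral_add]
    · congr 1
      ext1 z
      rw [fderiv_fun_mul ((hχ m).differentiable one_ne_zero z)
        (hg.differentiable one_ne_zero z)]
      simp
    · exact hfi.bdd_mul (hχ m).continuous.aestronglyMeasurable (ae_of_all _ (hχnorm m))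
    · exact (hχi m).integrableOn.bdd_mul hg.continuous.aestronglyMeasurable (ae_of_all _ hM)
  have hlim := (hL1.add hL2).sub hL3
  have hconst : ∀ m, (∫ z in D, χ m z * fderiv ℝ g z v) + (∫ z in D, g z * fderiv ℝ (χ m) z v)
      - ∫ z, χ m z * g z * ⟪outwardNormal D z, v⟫ ∂surfaceMeasure D = 0 := fun m => by
    rw [← hsplit]; exact hzero m
  simp only [hconst, add_zero] at hlim
  exact (tendsto_nhds_unique hlim tendsto_const_nhds)

lemma divergenceDefect_add [IsFiniteMeasure (surfaceMeasure D)] (v : 𝔼) {f g : 𝔼 → ℝ}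
    (hf : ContDiff ℝ 1 f) (hg : ContDiff ℝ 1 g) (hfc : HasCompactSupport f)
    (hgc : HasCompactSupport g) :
    divergenceDefect D v (fun z => f z + g z) =
      divergenceDefect D v f + divergenceDefect D v g := by
  have h := divergenceDefect_sum (D := D) (Finset.univ : Finset (Fin 2)) v (g := ![f, g])
    (by simp [Fin.forall_fin_two, hf, hg]) (by simp [Fin.forall_fin_two, hfc, hgc])
  simpa [Fin.sum_univ_two] using h

/-- **Divergence theorem** for bounded sets with piecewise `C¹` boundary. -/
theorem setIntegral_fderiv_eq_integral_surfaceMeasure (hd : 2 ≤ d)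
    (hD : HasPiecewiseC1Boundary D) (hbdd : Bornology.IsBounded D) (v : 𝔼) {g : 𝔼 → ℝ}
    (hg : ContDiff ℝ 1 g) :
    ∫ z in D, fderiv ℝ g z v = ∫ z, g z * ⟪outwardNormal D z, v⟫ ∂surfaceMeasure D := by
  have hfin := hD.isFiniteMeasure
  obtain ⟨R, hR, hDR⟩ := hbdd.closure.subset_ball_lt 0 0
  let b : ContDiffBump (0 : 𝔼) := ⟨R, R + 1, hR, lt_add_one R⟩
  have hb : ContDiff ℝ 1 b := b.contDiff
  have hbc : HasCompactSupport b := b.hasCompactSupport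
  obtain ⟨M, hM⟩ := (hbc.mul_left (f := g)).exists_bound_of_continuous
    (hg.mul hb).continuous
  -- The function `b(M + gb)` is nonnegative because `M` bounds `|gb|`. Subtracting the result for
  -- `Mb` leaves `gb²`, which equals `g` near the closure of `D`.
  have h1 := divergenceDefect_eq_zero_of_nonneg' hd hD hbdd v
    (g := fun z => M * b z + g z * b z * b z)
    ((contDiff_const.mul hb).add ((hg.mul hb).mul hb)) (hbc.mul_left.add hbc.mul_left)
    fun z => by
      have := neg_le_of_abs_le (hM z)
      have h2 : 0 ≤ b z := b.nonneg
      simp only [Pi.mul_apply] at this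
      nlinarith
  have hM0 : 0 ≤ M := (norm_nonneg _).trans (hM 0)
  have h2 := divergenceDefect_eq_zero_of_nonneg' hd hD hbdd v (g := fun z => M * b z)
    (contDiff_const.mul hb) hbc.mul_left fun z => mul_nonneg hM0 b.nonneg
  rw [divergenceDefect_add v (contDiff_const.mul hb) ((hg.mul hb).mul hb) hbc.mul_left
    hbc.mul_left, h2, zero_add] at h1
  have heq : ∀ z ∈ closure D, (fun z => g z * b z * b z) =ᶠ[𝓝 z] g := fun z hz => by
    filter_upwards [isOpen_ball.mem_nhds (hDR hz)] with w hw
    rw [b.one_of_mem_closedBall (ball_subset_closedBall hw), mul_one, mul_one]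
  have e1 : ∫ z in D, fderiv ℝ (fun z => g z * b z * b z) z v = ∫ z in D, fderiv ℝ g z v := by
    refine setIntegral_congr_ae₀ (hD.nullMeasurableSet (by omega)) (ae_of_all _ fun z hz => ?_)
    rw [(heq z (subset_closure hz)).fderiv_eq]
  have e2 : ∫ z, g z * b z * b z * ⟪outwardNormal D z, v⟫ ∂surfaceMeasure D
      = ∫ z, g z * ⟪outwardNormal D z, v⟫ ∂surfaceMeasure D := by
    refine setIntegral_congr_fun isClosed_frontier.measurableSet fun z hz => ?_
    rw [(heq z (frontier_subset_closure hz)).eq_of_nhds]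
  rw [divergenceDefect, e1, e2, sub_eq_zero] at h1
  exact h1

end DivergenceTheorem

/-! ### Polar coordinates and star-shaped regions -/

section Polar

variable {E : Type*} [NormedAddCommGroup E] [NormedSpace ℝ E] [FiniteDimensional ℝ E]
  [MeasurableSpace E] [BorelSpace E] [Nontrivial E] (μ : Measure E) [μ.IsAddHaarMeasure]

lemma integral_volumeIoiPow (k : ℕ) (f : ℝ → ℝ) :
    ∫ r, f r ∂(Measure.volumeIoiPow k) = ∫ r in Ioi (0 : ℝ), r ^ k * f r := by
  rw [Measure.volumeIoiPow, integral_withDensity_eq_integral_toReal_smul (by fun_prop) (by simp),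
    ← integral_subtype_comap measurableSet_Ioi fun r => r ^ k * f r]
  refine integral_congr_ae (ae_of_all _ fun r => ?_)
  simp only [smul_eq_mul]
  rw [ENNReal.toReal_ofReal (pow_nonneg (le_of_lt r.2) k)]

/-- Integration in polar coordinates. -/
lemma integrable_and_integral_eq_polar {F : E → ℝ} (hF : Integrable F μ) :
    Integrable (fun θ : sphere (0 : E) 1 =>
        ∫ r in Ioi (0 : ℝ), r ^ (Module.finrank ℝ E - 1) * F (r • (θ : E))) μ.toSphere ∧
      ∫ z, F z ∂μ = ∫ θ : sphere (0 : E) 1,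
        (∫ r in Ioi (0 : ℝ), r ^ (Module.finrank ℝ E - 1) * F (r • (θ : E))) ∂μ.toSphere := by
  set k := Module.finrank ℝ E - 1
  let P : sphere (0 : E) 1 × Ioi (0 : ℝ) → ℝ := fun q => F ((q.2 : ℝ) • (q.1 : E))
  have hP : P ∘ homeomorphUnitSphereProd E = fun z : ({0}ᶜ : Set E) => F z := by
    funext z
    have := congrArg Subtype.val ((homeomorphUnitSphereProd E).symm_apply_apply z)
    simp only [homeomorphUnitSphereProd_symm_apply_coe] at this
    simp only [Function.comp_apply, P]
    rw [this]
  have hmp := μ.measurePreserving_homeomorphUnitSphereProd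
  have hemb := (homeomorphUnitSphereProd E).measurableEmbedding
  have hsub : Integrable (fun z : ({0}ᶜ : Set E) => F z) (μ.comap (↑)) :=
    (integrableOn_iff_comap_subtypeVal (measurableSet_singleton _).compl).1 hF.integrableOn
  have hPi : Integrable P (μ.toSphere.prod (Measure.volumeIoiPow k)) := by
    rw [← hmp.integrable_comp_emb hemb, hP]
    exact hsub
  have hinner : ∀ θ : sphere (0 : E) 1, ∫ r, P (θ, r) ∂(Measure.volumeIoiPow k)
      = ∫ r in Ioi (0 : ℝ), r ^ k * F (r • (θ : E)) := fun θ =>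
    integral_volumeIoiPow k fun r => F (r • (θ : E))
  have h1 := hPi.integral_prod_left
  simp only [hinner] at h1
  refine ⟨h1, ?_⟩
  simp only [← hinner]
  rw [← integral_prod _ hPi, ← hmp.integral_comp hemb]
  have : ∀ z : ({0}ᶜ : Set E), P (homeomorphUnitSphereProd E z) = F z := fun z => congrFun hP z
  simp only [this]
  rw [integral_subtype_comap (measurableSet_singleton _).compl F, restrict_compl_singleton]

/-- Integration in polar coordinates over a region that is star-shaped about `x`. -/
lemma integrable_and_setIntegral_eq_polar {D : Set E} (hD : NullMeasurableSet D μ)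
    (hbdd : Bornology.IsBounded D) {x : E} {ρ : sphere (0 : E) 1 → ℝ} (hρ0 : ∀ θ, 0 ≤ ρ θ)
    (hρ : ∀ (θ : sphere (0 : E) 1) (t : ℝ), 0 < t → (x - t • (θ : E) ∈ D ↔ t ≤ ρ θ))
    {f : E → ℝ} (hf : Continuous f) :
    Integrable (fun θ : sphere (0 : E) 1 =>
        ∫ r in (0 : ℝ)..ρ θ, r ^ (Module.finrank ℝ E - 1) * f (r • (θ : E))) μ.toSphere ∧
      ∫ y in D, f (x - y) ∂μ = ∫ θ : sphere (0 : E) 1,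
        (∫ r in (0 : ℝ)..ρ θ, r ^ (Module.finrank ℝ E - 1) * f (r • (θ : E))) ∂μ.toSphere := by
  classical
  have hint : Integrable (D.indicator fun y => f (x - y)) μ := by
    refine IntegrableOn.integrable_indicator₀ ?_ hD
    have hc : Continuous fun y => f (x - y) := by fun_prop
    exact (hc.continuousOn.integrableOn_compact hbdd.isCompact_closure).mono_set subset_closure
  have h := integrable_and_integral_eq_polar μ (hint.comp_sub_left x)
  have hinner : ∀ θ : sphere (0 : E) 1, ∫ r in Ioi (0 : ℝ), r ^ (Module.finrank ℝ E - 1) *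
      D.indicator (fun y => f (x - y)) (x - r • (θ : E))
      = ∫ r in (0 : ℝ)..ρ θ, r ^ (Module.finrank ℝ E - 1) * f (r • (θ : E)) := fun θ => by
    rw [intervalIntegral.integral_of_le (hρ0 θ), ← integral_indicator measurableSet_Ioi,
      ← integral_indicator measurableSet_Ioc]
    congr 1
    ext1 r
    by_cases hr : 0 < r
    · rw [indicator_of_mem (mem_Ioi.2 hr), indicator_apply, indicator_apply]
      simp only [hρ θ r hr, mem_Ioc, hr, true_and, sub_sub_cancel]
      split_ifs <;> simp
    · rw [indicator_of_notMem (by simpa using hr), indicator_of_notMem fun h => hr h.1]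
  simp only [hinner] at h
  refine ⟨h.1, ?_⟩
  rw [← h.2, integral_sub_left_eq_self (D.indicator fun y => f (x - y)) μ x,
    integral_indicator₀ hD]

end Polar

section PolarRegion

variable {d : ℕ} {x : EuclideanSpace ℝ (Fin d)}
  {ρ : sphere (0 : EuclideanSpace ℝ (Fin d)) 1 → ℝ}

lemma sub_smul_mem_polarRegion_iff (θ : sphere (0 : EuclideanSpace ℝ (Fin d)) 1) {t : ℝ}
    (ht : 0 < t) : x - t • (θ : EuclideanSpace ℝ (Fin d)) ∈ polarRegion x ρ ↔ t ≤ ρ θ := by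
  constructor
  · rintro ⟨θ', t', ht', hle, h⟩
    have h1 : t • (θ : EuclideanSpace ℝ (Fin d)) = t' • (θ' : EuclideanSpace ℝ (Fin d)) :=
      sub_right_injective h
    have h2 : t = t' := by
      have := congrArg norm h1
      rwa [norm_smul, norm_smul, norm_eq_of_mem_sphere, norm_eq_of_mem_sphere, mul_one, mul_one,
        Real.norm_of_nonneg ht.le, Real.norm_of_nonneg ht'] at this
    subst h2
    have h3 : θ = θ' := Subtype.ext (smul_right_injective _ ht.ne' h1)
    rwa [h3]
  · exact fun h => ⟨θ, t, ht.le, h, rfl⟩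

lemma le_of_ball_subset_polarRegion {r : ℝ} (hr : 0 < r) (h : ball x r ⊆ polarRegion x ρ)
    (θ : sphere (0 : EuclideanSpace ℝ (Fin d)) 1) : r ≤ ρ θ := by
  have key : ∀ t, 0 < t → t < r → t ≤ ρ θ := fun t h0 ht => by
    refine (sub_smul_mem_polarRegion_iff θ h0).1 (h ?_)
    rw [mem_ball, dist_eq_norm, sub_sub_cancel_left, norm_neg, norm_smul, norm_eq_of_mem_sphere,
      mul_one, Real.norm_of_nonneg h0.le]
    exact ht
  -- The bound is known only for positive `t`; passing to the maximum with `r / 2` covers the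
  -- others.
  refine le_of_forall_lt_imp_le_of_dense fun t ht => ?_
  exact (le_max_left t (r / 2)).trans
    (key _ (lt_max_of_lt_right (half_pos hr)) (max_lt ht (half_lt_self hr)))

end PolarRegion

/-! ### Radial integrals of the regularised field -/

section RadialField

variable {d : ℕ}

local notation "𝔼" => EuclideanSpace ℝ (Fin d)

/-- The partial derivative `∂ᵢ` of the field `w ↦ w j * q (|w| ^ 2)`. -/
def radialDeriv (q : ℝ → ℝ) (i j : Fin d) (w : 𝔼) : ℝ :=
  kron i j * q (‖w‖ ^ 2) + 2 * (w i * w j) * deriv q (‖w‖ ^ 2)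

lemma continuous_radialDeriv {q : ℝ → ℝ} (hq : ContDiff ℝ 1 q) (i j : Fin d) :
    Continuous (radialDeriv q i j) := by
  have h1 := hq.continuous
  have h2 := hq.continuous_deriv le_rfl
  unfold radialDeriv
  fun_prop

lemma contDiff_radialField {q : ℝ → ℝ} (hq : ContDiff ℝ 1 q) (j : Fin d) :
    ContDiff ℝ 1 fun w : 𝔼 => w j * q (‖w‖ ^ 2) := by
  have h1 : ContDiff ℝ 1 fun w : 𝔼 => w j := (EuclideanSpace.proj (𝕜 := ℝ) j).contDiff
  exact h1.mul (hq.comp (contDiff_norm_sq ℝ))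

lemma fderiv_radialField {q : ℝ → ℝ} (hq : ContDiff ℝ 1 q) (i j : Fin d) (w : 𝔼) :
    fderiv ℝ (fun w : 𝔼 => w j * q (‖w‖ ^ 2)) w (EuclideanSpace.single i 1)
      = radialDeriv q i j w := by
  have h1 : HasFDerivAt (fun w : 𝔼 => w j) (EuclideanSpace.proj (𝕜 := ℝ) j) w :=
    (EuclideanSpace.proj (𝕜 := ℝ) j).hasFDerivAt
  have h2 : HasFDerivAt (fun w : 𝔼 => ‖w‖ ^ 2) (2 • innerSL ℝ w) w :=
    (hasStrictFDerivAt_norm_sq w).hasFDerivAt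
  have h3 : HasDerivAt q (deriv q (‖w‖ ^ 2)) (‖w‖ ^ 2) :=
    (hq.differentiable one_ne_zero _).hasDerivAt
  have h4 : HasFDerivAt (fun w : 𝔼 => w j * q (‖w‖ ^ 2)) _ w :=
    h1.mul (h3.comp_hasFDerivAt w h2)
  rw [h4.fderiv]
  simp [radialDeriv, kron, EuclideanSpace.inner_single_right, eq_comm]
  ring

/-- The radial integral of `radialDeriv`. -/
lemma integral_radialDeriv (hd : 0 < d) {q : ℝ → ℝ} (hq : ContDiff ℝ 1 q) (i j : Fin d)
    (θ : sphere (0 : 𝔼) 1) (s : ℝ) :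
    ∫ r in (0 : ℝ)..s, r ^ (d - 1) * radialDeriv q i j (r • (θ : 𝔼)) =
      (θ : 𝔼) i * (θ : 𝔼) j * (s ^ d * q (s ^ 2)) +
        (kron i j - d * ((θ : 𝔼) i * (θ : 𝔼) j)) * ∫ r in (0 : ℝ)..s, r ^ (d - 1) * q (r ^ 2) := by
  have hqc := hq.continuous
  have hqc' := hq.continuous_deriv le_rfl
  -- The term with `deriv q` is a total derivative up to a multiple of `r^(d-1) q(r²)`; this is what
  -- turns `kron i j` into `kron i j - d θᵢθⱼ`.
  have hder : ∀ r : ℝ, HasDerivAt (fun r : ℝ => r ^ d * q (r ^ 2))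
      (d * (r ^ (d - 1) * q (r ^ 2)) + 2 * (r ^ (d - 1) * r ^ 2) * deriv q (r ^ 2)) r := by
    intro r
    have h2 : HasDerivAt (fun r : ℝ => r ^ 2) (2 * r) r := by simpa using hasDerivAt_pow 2 r
    have h3 : HasDerivAt (fun r : ℝ => q (r ^ 2)) (deriv q (r ^ 2) * (2 * r)) r :=
      (hq.differentiable one_ne_zero _).hasDerivAt.comp r h2
    have h4 := (hasDerivAt_pow d r).mul h3
    have h5 : r ^ d = r ^ (d - 1) * r := (pow_sub_one_mul hd.ne' r).symm
    have h6 : d * r ^ (d - 1) * q (r ^ 2) + r ^ d * (deriv q (r ^ 2) * (2 * r))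
        = d * (r ^ (d - 1) * q (r ^ 2)) + 2 * (r ^ (d - 1) * r ^ 2) * deriv q (r ^ 2) := by
      rw [h5]; ring
    rw [h6] at h4
    exact h4
  have hftc : ∫ r in (0 : ℝ)..s, (d * (r ^ (d - 1) * q (r ^ 2)) +
      2 * (r ^ (d - 1) * r ^ 2) * deriv q (r ^ 2)) = s ^ d * q (s ^ 2) := by
    rw [intervalIntegral.integral_eq_sub_of_hasDerivAt (fun r _ => hder r)
      (Continuous.intervalIntegrable (by fun_prop) _ _)]
    simp [hd.ne']
  rw [← hftc, ← intervalIntegral.integral_const_mul, ← intervalIntegral.integral_const_mul,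
    ← intervalIntegral.integral_add (Continuous.intervalIntegrable (by fun_prop) _ _)
      (Continuous.intervalIntegrable (by fun_prop) _ _)]
  congr 1
  ext1 r
  have hn : ‖r • (θ : 𝔼)‖ ^ 2 = r ^ 2 := by
    rw [norm_smul, norm_eq_of_mem_sphere, mul_one, Real.norm_eq_abs, sq_abs]
  rw [radialDeriv, hn]
  simp only [PiLp.smul_apply, smul_eq_mul]
  ring

end RadialField

/-! ### Second moments of the unit sphere -/

section SphereMoments

variable {d : ℕ}

local notation "𝔼" => EuclideanSpace ℝ (Fin d)
local notation "σS" => Measure.toSphere (volume : Measure (EuclideanSpace ℝ (Fin d)))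

lemma continuous_sphere_coord (i : Fin d) :
    Continuous fun θ : sphere (0 : 𝔼) 1 => (θ : 𝔼) i :=
  (EuclideanSpace.proj (𝕜 := ℝ) i).continuous.comp continuous_subtype_val

lemma abs_sphere_coord_le (i : Fin d) (θ : sphere (0 : 𝔼) 1) : |(θ : 𝔼) i| ≤ 1 := by
  simpa [norm_eq_of_mem_sphere] using PiLp.norm_apply_le (θ : 𝔼) i

lemma integrable_sphere_mul (i j : Fin d) :
    Integrable (fun θ : sphere (0 : 𝔼) 1 => (θ : 𝔼) i * (θ : 𝔼) j) σS := by
  refine Integrable.of_bound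
    ((continuous_sphere_coord i).mul (continuous_sphere_coord j)).aestronglyMeasurable 1
    (ae_of_all _ fun θ => ?_)
  rw [norm_mul]
  exact mul_le_one₀ (abs_sphere_coord_le i θ) (norm_nonneg _) (abs_sphere_coord_le j θ)

/-- The function `δᵢⱼ - d θᵢ θⱼ` has vanishing integral over the unit sphere. -/
lemma integral_sphere_kron_sub (hd : 0 < d) (i j : Fin d) :
    ∫ θ : sphere (0 : 𝔼) 1, (kron i j - d * ((θ : 𝔼) i * (θ : 𝔼) j)) ∂σS = 0 := by
  have : Nonempty (Fin d) := ⟨i⟩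
  let β : ContDiffBump (0 : ℝ) := ⟨1, 2, one_pos, one_lt_two⟩
  have hβ : ContDiff ℝ 1 β := β.contDiff
  have hβ0 : ∀ s : ℝ, 2 ≤ s → β s = 0 := fun s hs => by
    refine β.zero_of_le_dist ?_
    rw [dist_zero_right, Real.norm_of_nonneg (by linarith)]
    exact hs
  -- The derivative of this compactly supported function has integral zero. In polar coordinates
  -- that integral is the wanted sphere integral times a positive radial constant, as `β` vanishes
  -- at `2²` and kills the endpoint term.
  let u : 𝔼 → ℝ := fun w => w j * β (‖w‖ ^ 2)
  have hu : ContDiff ℝ 1 u := contDiff_radialField hβ j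
  have hsupp : Function.support u ⊆ closedBall 0 2 := fun w hw => by
    by_contra hcon
    rw [mem_closedBall, dist_zero_right, not_le] at hcon
    refine hw ?_
    simp only [u]
    rw [hβ0 _ (by nlinarith), mul_zero]
  have huc : HasCompactSupport u :=
    HasCompactSupport.of_support_subset_isCompact (isCompact_closedBall 0 2) hsupp
  have hder : ∀ w, fderiv ℝ u w (EuclideanSpace.single i 1) = radialDeriv β i j w :=
    fderiv_radialField hβ i j
  have h1 := (integrable_and_setIntegral_eq_polar (volume : Measure 𝔼) (D := closedBall 0 2)
    (x := 0) (ρ := fun _ => 2) measurableSet_closedBall.nullMeasurableSet isBounded_closedBall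
    (fun _ => zero_le_two) (fun θ t ht => by
      rw [mem_closedBall, dist_zero_right, zero_sub, norm_neg, norm_smul, norm_eq_of_mem_sphere,
        mul_one, Real.norm_of_nonneg ht.le]) (continuous_radialDeriv hβ i j)).2
  have h2 : ∫ y in closedBall (0 : 𝔼) 2, radialDeriv β i j (0 - y) = 0 := by
    rw [setIntegral_eq_integral_of_forall_compl_eq_zero,
      integral_sub_left_eq_self (radialDeriv β i j) volume 0]
    · simp only [← hder]
      exact integral_fderiv_apply_eq_zero hu huc _
    · intro y hy
      rw [← hder]
      refine fderiv_apply_eq_zero_of_notMem_tsupport (fun h => hy ?_) _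
      have := closure_minimal hsupp isClosed_closedBall h
      simpa using this
  rw [h2] at h1
  simp only [finrank_euclideanSpace, Fintype.card_fin, integral_radialDeriv hd hβ] at h1
  rw [hβ0 (2 ^ 2) (by norm_num)] at h1
  simp only [mul_zero, zero_add] at h1
  rw [integral_mul_const] at h1
  refine (mul_eq_zero.1 h1.symm).resolve_right (ne_of_gt ?_)
  have hc : Continuous fun r : ℝ => r ^ (d - 1) * β (r ^ 2) := by
    have := hβ.continuous
    fun_prop
  refine intervalIntegral.integral_pos zero_lt_two hc.continuousOn
    (fun r hr => mul_nonneg (pow_nonneg hr.1.le _) β.nonneg) ⟨1, by norm_num, ?_⟩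
  have : β ((1 : ℝ) ^ 2) = 1 := β.one_of_mem_closedBall (by simp [β])
  rw [this]; norm_num

lemma integral_sphere_mul (hd : 0 < d) (i j : Fin d) :
    ∫ θ : sphere (0 : 𝔼) 1, (θ : 𝔼) i * (θ : 𝔼) j ∂σS =
      kron i j * (volume : Measure 𝔼).real (ball 0 1) := by
  have h := integral_sphere_kron_sub hd i j
  rw [integral_sub (integrable_const _) ((integrable_sphere_mul i j).const_mul _),
    integral_const_mul, integral_const, Measure.toSphere_real_apply_univ] at h
  simp only [finrank_euclideanSpace, Fintype.card_fin, smul_eq_mul] at h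
  have hd' : (d : ℝ) ≠ 0 := by exact_mod_cast hd.ne'
  have h3 : (d : ℝ) * (∫ θ : sphere (0 : 𝔼) 1, (θ : 𝔼) i * (θ : 𝔼) j ∂σS)
      = d * (kron i j * (volume : Measure 𝔼).real (ball 0 1)) := by linarith
  exact mul_left_cancel₀ hd' h3

end SphereMoments

/-! ### The regularised radial profile -/

section Profile

/-- A `C¹` function on the line whose value at `r ^ 2` is `r ^ (-d)` for `r ≥ b`. -/
lemma exists_radial_profile (d : ℕ) {b : ℝ} (hb : 0 < b) :
    ∃ q : ℝ → ℝ, ContDiff ℝ 1 q ∧ ∀ r, b ≤ r → q (r ^ 2) = (r ^ d)⁻¹ := by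
  let T : ℝ → ℝ := fun s => Real.smoothTransition (s / b ^ 2)
  have hT : ContDiff ℝ 1 T := Real.smoothTransition.contDiff.comp (contDiff_id.div_const _)
  -- A blend of `s` and `b²`: it is `b²` for `s ≤ 0` and `s` for `s ≥ b²`, hence positive
  -- everywhere, so its real powers stay `C¹`.
  let φ : ℝ → ℝ := fun s => s * T s + b ^ 2 * (1 - T s)
  have hφ : ContDiff ℝ 1 φ :=
    (contDiff_id.mul hT).add (contDiff_const.mul (contDiff_const.sub hT))
  have hb2 : 0 < b ^ 2 := by positivity
  have hpos : ∀ s, 0 < φ s := fun s => by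
    simp only [φ]
    rcases le_or_gt s 0 with hs | hs
    · have : T s = 0 := Real.smoothTransition.zero_of_nonpos (div_nonpos_of_nonpos_of_nonneg hs hb2.le)
      rw [this]; linarith
    · have h0 : 0 ≤ T s := Real.smoothTransition.nonneg _
      have h1 : T s ≤ 1 := Real.smoothTransition.le_one _
      rcases h0.eq_or_lt with h | h
      · rw [← h]; linarith
      · have := mul_pos hs h
        have := mul_nonneg hb2.le (sub_nonneg.2 h1)
        linarith
  refine ⟨fun s => φ s ^ (-(d : ℝ) / 2), hφ.rpow_const_of_ne fun s => (hpos s).ne',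
    fun r hr => ?_⟩
  have hr0 : 0 ≤ r := hb.le.trans hr
  have hT1 : T (r ^ 2) = 1 := Real.smoothTransition.one_of_one_le
    ((one_le_div hb2).2 (pow_le_pow_left₀ hb.le hr 2))
  have h1 : φ (r ^ 2) = r ^ 2 := by simp only [φ, hT1]; ring
  simp only [h1]
  rw [← Real.rpow_natCast r 2, ← Real.rpow_mul hr0, ← Real.rpow_natCast, ← Real.rpow_neg hr0]
  congr 1
  push_cast
  ring

/-- Beyond `b` the integrand is `1 / r`, which is the source of the logarithm. -/
lemma integral_radial_profile {d : ℕ} (hd : 0 < d) {b : ℝ} (hb : 0 < b) {q : ℝ → ℝ}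
    (hq : Continuous q) (hqb : ∀ r, b ≤ r → q (r ^ 2) = (r ^ d)⁻¹) {s : ℝ} (hs : b ≤ s) :
    ∫ r in (0 : ℝ)..s, r ^ (d - 1) * q (r ^ 2) =
      ((∫ r in (0 : ℝ)..b, r ^ (d - 1) * q (r ^ 2)) - Real.log b) + Real.log s := by
  have hc : Continuous fun r : ℝ => r ^ (d - 1) * q (r ^ 2) := by fun_prop
  rw [← intervalIntegral.integral_add_adjacent_intervals (hc.intervalIntegrable 0 b)
    (hc.intervalIntegrable b s)]
  have h1 : ∫ r in b..s, r ^ (d - 1) * q (r ^ 2) = ∫ r in b..s, r⁻¹ := by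
    refine intervalIntegral.integral_congr fun r hr => ?_
    rw [uIcc_of_le hs] at hr
    have hr0 : 0 < r := hb.trans_le hr.1
    rw [hqb r hr.1, ← pow_sub_one_mul hd.ne' r]
    field_simp
  rw [h1, integral_inv_of_pos hb (hb.trans_le hs), Real.log_div (hb.trans_le hs).ne' hb.ne']
  ring

end Profile

/-! ### Derivatives of the Green function -/

section Green

lemma hasFDerivAt_norm_of_ne_zero {F : Type*} [NormedAddCommGroup F] [InnerProductSpace ℝ F]
    {w : F} (hw : w ≠ 0) : HasFDerivAt (fun w : F => ‖w‖) (‖w‖⁻¹ • innerSL ℝ w) w := by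
  have hw' : 0 < ‖w‖ := norm_pos_iff.2 hw
  have h := (hasStrictFDerivAt_norm_sq w).hasFDerivAt.sqrt (by positivity)
  simp only [Real.sqrt_sq (norm_nonneg _)] at h
  refine h.congr_fderiv ?_
  rw [← Nat.cast_smul_eq_nsmul ℝ, smul_smul]
  congr 1
  push_cast
  field_simp

/-- The constant `c` with `∂ⱼ G (x, y) = c (x - y)ⱼ / |x - y| ^ d`. -/
def greenConst (d : ℕ) : ℝ := if d = 2 then 1 / (2 * Real.pi) else -(1 / (4 * Real.pi))

variable {d : ℕ}

local notation "𝔼" => EuclideanSpace ℝ (Fin d)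

lemma greenAngular_eq (hd : d = 2 ∨ d = 3) (i j : Fin d) (θ : 𝔼) :
    greenAngular i j θ = greenConst d * (kron i j - d * (θ i * θ j)) := by
  rcases hd with rfl | rfl
  · simp [greenAngular, greenConst]
  · simp [greenAngular, greenConst]

lemma greenConst_mul_volume (hd : d = 2 ∨ d = 3) :
    greenConst d * (volume : Measure 𝔼).real (ball 0 1) = greenSign d / d := by
  have hπ := Real.pi_pos
  rcases hd with rfl | rfl
  · rw [measureReal_def, EuclideanSpace.volume_ball_fin_two]
    simp [greenConst, greenSign, hπ.le]
    field_simp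
  · rw [measureReal_def, EuclideanSpace.volume_ball_fin_three]
    rw [ENNReal.toReal_mul, ENNReal.toReal_ofReal (by positivity)]
    simp [greenConst, greenSign]
    field_simp

lemma greenFn_comm (x y : 𝔼) : greenFn d x y = greenFn d y x := by
  rw [greenFn, greenFn, norm_sub_rev]

lemma hasFDerivAt_greenFn (hd : d = 2 ∨ d = 3) {x y : 𝔼} (hxy : x ≠ y) :
    HasFDerivAt (fun z => greenFn d z y)
      ((greenConst d * (‖x - y‖ ^ d)⁻¹) • innerSL ℝ (x - y)) x := by
  have hw : x - y ≠ 0 := sub_ne_zero.2 hxy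
  have hw' : 0 < ‖x - y‖ := norm_pos_iff.2 hw
  have h1 : HasFDerivAt (fun z : 𝔼 => ‖z - y‖) (‖x - y‖⁻¹ • innerSL ℝ (x - y)) x := by
    have := (hasFDerivAt_norm_of_ne_zero hw).comp x ((hasFDerivAt_id x).sub_const y)
    exact this
  rcases hd with rfl | rfl
  · have h2 := ((Real.hasDerivAt_log hw'.ne').comp_hasFDerivAt x h1).const_mul
      (1 / (2 * Real.pi))
    have h3 : (fun z => greenFn 2 z y) = fun z => 1 / (2 * Real.pi) * Real.log ‖z - y‖ := by
      funext z; simp [greenFn]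
    rw [h3]
    refine HasFDerivAt.congr_fderiv h2 ?_
    rw [smul_smul, smul_smul]
    congr 1
    simp [greenConst]
    field_simp
  · have h2 := ((hasDerivAt_inv hw'.ne').comp_hasFDerivAt x h1).const_mul (1 / (4 * Real.pi))
    have h3 : (fun z => greenFn 3 z y) = fun z => 1 / (4 * Real.pi) * ‖z - y‖⁻¹ := by
      funext z; simp [greenFn]
    rw [h3]
    refine HasFDerivAt.congr_fderiv h2 ?_
    rw [smul_smul, smul_smul]
    congr 1
    simp [greenConst]
    field_simp

lemma pderivAt_greenFn (hd : d = 2 ∨ d = 3) {x y : 𝔼} (hxy : x ≠ y) (j : Fin d) :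
    pderivAt j (fun z => greenFn d z y) x = greenConst d * ((x - y) j * (‖x - y‖ ^ d)⁻¹) := by
  rw [pderivAt, (hasFDerivAt_greenFn hd hxy).fderiv]
  simp [EuclideanSpace.inner_single_right]
  ring

/-- Differentiating in `y` instead of `x` changes the sign, which cancels the minus sign in the
normalisation `Γ = -sG`. -/
lemma pderivAt_newtonFn (hd : d = 2 ∨ d = 3) {x y : 𝔼} (hxy : x ≠ y) (j : Fin d) :
    pderivAt j (fun z => newtonFn d x z) y =
      greenSign d * pderivAt j (fun z => greenFn d z y) x := by
  have h := (hasFDerivAt_greenFn hd hxy.symm).const_mul (-greenSign d)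
  have h1 : (fun z => newtonFn d x z) = fun z => -greenSign d * greenFn d z x := by
    funext z; rw [newtonFn, greenFn_comm]
  rw [pderivAt_greenFn hd hxy, pderivAt, h1, h.fderiv, ← neg_sub y x, norm_neg]
  simp [EuclideanSpace.inner_single_right]
  ring

end Green

/-! ### The boundary integral -/

section BoundaryIntegral

variable {d : ℕ} {D : Set (EuclideanSpace ℝ (Fin d))} {x : EuclideanSpace ℝ (Fin d)}
  {ρ : sphere (0 : EuclideanSpace ℝ (Fin d)) 1 → ℝ}

local notation "𝔼" => EuclideanSpace ℝ (Fin d)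
local notation "σS" => Measure.toSphere (volume : Measure (EuclideanSpace ℝ (Fin d)))

/-- The set-up of the radial profile: a smooth radial function that agrees with `|w| ^ (-d)` on
`x - y` for the boundary points `y`, together with its radial integral. -/
lemma exists_profile_of_mem_interior (hd : 2 ≤ d) (hbdd : Bornology.IsBounded D)
    (hD : HasPiecewiseC1Boundary D) (hx : x ∈ interior D) (hρ : D = polarRegion x ρ) :
    ∃ (q : ℝ → ℝ) (C : ℝ), ContDiff ℝ 1 q ∧
      (∀ y ∈ frontier D, x ≠ y ∧ q (‖x - y‖ ^ 2) = (‖x - y‖ ^ d)⁻¹) ∧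
      Integrable (fun θ => Real.log (ρ θ)) σS ∧
      ∀ i j, ∫ y in D, radialDeriv q i j (x - y) = ∫ θ : sphere (0 : 𝔼) 1,
        ((θ : 𝔼) i * (θ : 𝔼) j +
          (kron i j - d * ((θ : 𝔼) i * (θ : 𝔼) j)) * (C + Real.log (ρ θ))) ∂σS := by
  have hd0 : 0 < d := by omega
  have : Nonempty (Fin d) := ⟨⟨0, hd0⟩⟩
  obtain ⟨b, hb, hball⟩ := Metric.isOpen_iff.1 isOpen_interior x hx
  obtain ⟨q, hq, hqb⟩ := exists_radial_profile d hb
  have hbρ : ∀ θ, b ≤ ρ θ :=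
    le_of_ball_subset_polarRegion hb (hρ ▸ hball.trans interior_subset)
  have hQ := fun θ => integral_radial_profile hd0 hb hq.continuous hqb (hbρ θ)
  set C := (∫ r in (0 : ℝ)..b, r ^ (d - 1) * q (r ^ 2)) - Real.log b
  have hnull := hD.nullMeasurableSet hd0
  have hmem : ∀ (θ : sphere (0 : 𝔼) 1) (t : ℝ), 0 < t → (x - t • (θ : 𝔼) ∈ D ↔ t ≤ ρ θ) :=
    fun θ t ht => by rw [hρ, sub_smul_mem_polarRegion_iff θ ht]
  have hρ0 : ∀ θ, 0 < ρ θ := fun θ => hb.trans_le (hbρ θ)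
  have hpolar := fun {f : 𝔼 → ℝ} (hf : Continuous f) =>
    integrable_and_setIntegral_eq_polar (volume : Measure 𝔼) hnull hbdd
      (fun θ => (hρ0 θ).le) hmem hf
  simp only [finrank_euclideanSpace, Fintype.card_fin] at hpolar
  refine ⟨q, C, hq, fun y hy => ?_, ?_, fun i j => ?_⟩
  · have hby : b ≤ ‖x - y‖ := by
      by_contra hlt
      refine hy.2 (hball (mem_ball.2 ?_))
      rw [dist_comm, dist_eq_norm]
      exact not_le.1 hlt
    exact ⟨sub_ne_zero.1 (norm_pos_iff.1 (hb.trans_le hby)), hqb _ hby⟩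
  · have hf : Continuous fun w : 𝔼 => q (‖w‖ ^ 2) := by
      have := hq.continuous
      fun_prop
    have h1 := (hpolar hf).1.sub (integrable_const C)
    refine h1.congr (ae_of_all _ fun θ => ?_)
    have h2 : ∀ r : ℝ, ‖r • (θ : 𝔼)‖ ^ 2 = r ^ 2 := fun r => by
      rw [norm_smul, norm_eq_of_mem_sphere, mul_one, Real.norm_eq_abs, sq_abs]
    simp only [Pi.sub_apply, h2, hQ]
    ring
  · rw [(hpolar (continuous_radialDeriv hq i j)).2]
    congr 1
    ext1 θ
    rw [integral_radialDeriv hd0 hq, hQ, hqb _ (hbρ θ),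
      mul_inv_cancel₀ (pow_pos (hρ0 θ) d).ne', mul_one]

lemma integrable_greenAngular_mul_log (hd : d = 2 ∨ d = 3)
    (hlog : Integrable (fun θ => Real.log (ρ θ)) σS) (i j : Fin d) :
    Integrable (fun θ : sphere (0 : 𝔼) 1 => greenAngular i j (θ : 𝔼) * Real.log (ρ θ)) σS := by
  simp only [greenAngular_eq hd]
  have hc : Continuous fun θ : sphere (0 : 𝔼) 1 =>
      greenConst d * (kron i j - d * ((θ : 𝔼) i * (θ : 𝔼) j)) := by
    have h1 := continuous_sphere_coord i
    have h2 := continuous_sphere_coord j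
    fun_prop
  obtain ⟨M, hM⟩ := isCompact_univ.exists_bound_of_continuousOn hc.continuousOn
  exact hlog.bdd_mul hc.aestronglyMeasurable (ae_of_all _ fun θ => hM θ (mem_univ θ))

lemma boundary_integral_pderivAt_greenFn (hd : d = 2 ∨ d = 3) (hbdd : Bornology.IsBounded D)
    (hD : HasPiecewiseC1Boundary D) (hx : x ∈ interior D) (hρ : D = polarRegion x ρ)
    (i j : Fin d) :
    Integrable (fun y => pderivAt j (fun z => greenFn d z y) x * (outwardNormal D y) i)
        (surfaceMeasure D) ∧
      Integrable (fun θ : sphere (0 : 𝔼) 1 => greenAngular i j (θ : 𝔼) * Real.log (ρ θ)) σS ∧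
      ∫ y, pderivAt j (fun z => greenFn d z y) x * (outwardNormal D y) i ∂(surfaceMeasure D) =
        -(greenSign d * kron i j / d) -
          ∫ θ : sphere (0 : 𝔼) 1, greenAngular i j (θ : 𝔼) * Real.log (ρ θ) ∂σS := by
  have hd2 : 2 ≤ d := by omega
  have hfin := hD.isFiniteMeasure
  obtain ⟨q, C, hq, hfr, hlog, hpolar⟩ := exists_profile_of_mem_interior hd2 hbdd hD hx hρ
  have hglog := integrable_greenAngular_mul_log hd hlog i j
  set c := greenConst d
  let e : 𝔼 := EuclideanSpace.single i 1
  let g : 𝔼 → ℝ := fun y => c * ((x - y) j * q (‖x - y‖ ^ 2))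
  have hu := contDiff_radialField hq j
  have hg : ContDiff ℝ 1 g := contDiff_const.mul (hu.comp (contDiff_const.sub contDiff_id))
  have hgfr : ∀ y ∈ frontier D, g y * ⟪outwardNormal D y, e⟫ =
      pderivAt j (fun z => greenFn d z y) x * (outwardNormal D y) i := fun y hy => by
    rw [pderivAt_greenFn hd (hfr y hy).1]
    simp only [g, e, (hfr y hy).2, EuclideanSpace.inner_single_right]
    simp [c]
  have hgi : Integrable g (surfaceMeasure D) := by
    have hK : IsCompact (frontier D) := isCompact_of_isClosed_isBounded isClosed_frontier
      (hbdd.closure.subset frontier_subset_closure)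
    obtain ⟨M, hM⟩ := hK.exists_bound_of_continuousOn hg.continuous.continuousOn
    exact Integrable.of_bound hg.continuous.aestronglyMeasurable M
      ((ae_restrict_iff' isClosed_frontier.measurableSet).2 (ae_of_all _ hM))
  have hgν := integrable_mul_outwardNormal hgi e
  refine ⟨hgν.congr ((ae_restrict_iff' isClosed_frontier.measurableSet).2
    (ae_of_all _ hgfr)), hglog, ?_⟩
  -- The minus sign comes from differentiating in `y` a function of `x - y`.
  have hder : ∀ y, fderiv ℝ g y e = -c * radialDeriv q i j (x - y) := fun y => by
    have h1 : HasFDerivAt (fun y : 𝔼 => x - y) (-ContinuousLinearMap.id ℝ 𝔼) y :=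
      (hasFDerivAt_id y).const_sub x
    have h2 := ((hu.differentiable one_ne_zero (x - y)).hasFDerivAt.comp y h1).const_mul c
    have h3 : HasFDerivAt g _ y := h2
    rw [h3.fderiv, ← fderiv_radialField hq i j (x - y)]
    simp [e]
  have hkron : Integrable (fun θ : sphere (0 : 𝔼) 1 =>
      kron i j - d * ((θ : 𝔼) i * (θ : 𝔼) j)) σS :=
    (integrable_const _).sub ((integrable_sphere_mul i j).const_mul _)
  -- The middle term carries the constant `C` and integrates to zero over the sphere.
  have hsplit : ∀ θ : sphere (0 : 𝔼) 1, -c * ((θ : 𝔼) i * (θ : 𝔼) j +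
      (kron i j - d * ((θ : 𝔼) i * (θ : 𝔼) j)) * (C + Real.log (ρ θ))) =
      (-c * ((θ : 𝔼) i * (θ : 𝔼) j) + -c * C * (kron i j - d * ((θ : 𝔼) i * (θ : 𝔼) j))) -
        greenAngular i j (θ : 𝔼) * Real.log (ρ θ) := fun θ => by
    rw [greenAngular_eq hd]; ring
  calc ∫ y, pderivAt j (fun z => greenFn d z y) x * (outwardNormal D y) i ∂(surfaceMeasure D)
      = ∫ y, g y * ⟪outwardNormal D y, e⟫ ∂(surfaceMeasure D) :=
        (setIntegral_congr_fun isClosed_frontier.measurableSet hgfr).symm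
    _ = ∫ y in D, fderiv ℝ g y e :=
        (setIntegral_fderiv_eq_integral_surfaceMeasure hd2 hD hbdd e hg).symm
    _ = -c * ∫ θ : sphere (0 : 𝔼) 1, ((θ : 𝔼) i * (θ : 𝔼) j +
          (kron i j - d * ((θ : 𝔼) i * (θ : 𝔼) j)) * (C + Real.log (ρ θ))) ∂σS := by
        simp only [hder]
        rw [integral_const_mul, hpolar i j]
    _ = (∫ θ : sphere (0 : 𝔼) 1, (-c * ((θ : 𝔼) i * (θ : 𝔼) j) +
          -c * C * (kron i j - d * ((θ : 𝔼) i * (θ : 𝔼) j))) ∂σS) -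
          ∫ θ : sphere (0 : 𝔼) 1, greenAngular i j (θ : 𝔼) * Real.log (ρ θ) ∂σS := by
        rw [← integral_const_mul, ← integral_sub _ hglog]
        · simp only [hsplit]
        · exact ((integrable_sphere_mul i j).const_mul _).add (hkron.const_mul _)
    _ = _ := by
        rw [integral_add ((integrable_sphere_mul i j).const_mul _) (hkron.const_mul _),
          integral_const_mul, integral_const_mul, integral_sphere_kron_sub (by omega),
          integral_sphere_mul (by omega)]
        have := greenConst_mul_volume (d := d) hd
        linear_combination (-kron i j) * this

end BoundaryIntegral

/-! ### Symmetry in the indices and conclusion -/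

lemma kron_comm {d : ℕ} (i j : Fin d) : kron i j = kron j i := by
  simp [kron, eq_comm]

lemma greenAngular_comm {d : ℕ} (i j : Fin d) (θ : EuclideanSpace ℝ (Fin d)) :
    greenAngular i j θ = greenAngular j i θ := by
  rw [greenAngular, greenAngular, kron_comm, mul_comm (θ i)]

lemma gradient_apply_eq_pderivAt {d : ℕ} (f : EuclideanSpace ℝ (Fin d) → ℝ)
    (x : EuclideanSpace ℝ (Fin d)) (i : Fin d) : (∇ f x) i = pderivAt i f x := by
  rw [pderivAt, ← inner_gradient_left, EuclideanSpace.inner_single_right]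
  simp

end

theorem mainTheorem9 (d : ℕ) (hd : d = 2 ∨ d = 3)
    (D : Set (EuclideanSpace ℝ (Fin d))) (hbdd : Bornology.IsBounded D)
    (hD : HasPiecewiseC1Boundary D)
    (x : EuclideanSpace ℝ (Fin d)) (hx : x ∈ interior D)
    (ρ : Metric.sphere (0 : EuclideanSpace ℝ (Fin d)) 1 → ℝ)
    (hρ : D = polarRegion x ρ) (i j : Fin d) :
    Integrable (fun y => pderivAt j (fun z => greenFn d z y) x * (outwardNormal D y) i)
        (surfaceMeasure D) ∧
    Integrable (fun θ : Metric.sphere (0 : EuclideanSpace ℝ (Fin d)) 1 =>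
        greenAngular i j θ * Real.log (ρ θ))
        (volume : Measure (EuclideanSpace ℝ (Fin d))).toSphere ∧
    dyadicL D x i j =
      ∫ y, pderivAt j (fun z => greenFn d z y) x * (outwardNormal D y) i
        ∂(surfaceMeasure D) ∧
    dyadicL D x i j =
      -(greenSign d * kron i j / d)
        - ∫ θ : Metric.sphere (0 : EuclideanSpace ℝ (Fin d)) 1,
            greenAngular i j θ * Real.log (ρ θ)
            ∂(volume : Measure (EuclideanSpace ℝ (Fin d))).toSphere ∧
    ∫ y, pderivAt j (fun z => newtonFn d x z) y * (outwardNormal D y) i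
        ∂(surfaceMeasure D) =
      -(kron i j / d)
        + ∫ θ : Metric.sphere (0 : EuclideanSpace ℝ (Fin d)) 1,
            newtonAngular i j θ * Real.log (ρ θ)
            ∂(volume : Measure (EuclideanSpace ℝ (Fin d))).toSphere := by
  obtain ⟨h1, h2, h3⟩ := boundary_integral_pderivAt_greenFn hd hbdd hD hx hρ i j
  -- The entry `(i, j)` of `dyadicL` pairs `∂ᵢG` with `νⱼ`, so the formula is also needed with the
  -- indices exchanged; its right side is symmetric in them.
  obtain ⟨-, -, h4⟩ := boundary_integral_pderivAt_greenFn hd hbdd hD hx hρ j i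
  have hL : dyadicL D x i j =
      ∫ y, pderivAt j (fun z => greenFn d z y) x * (outwardNormal D y) i
        ∂(surfaceMeasure D) := by
    rw [h3, dyadicL, Matrix.of_apply]
    simp only [gradient_apply_eq_pderivAt]
    rw [h4, kron_comm]
    simp only [greenAngular_comm j i]
  refine ⟨h1, h2, hL, hL.trans h3, ?_⟩
  have hne : ∀ y ∈ frontier D, x ≠ y := fun y hy h => hy.2 (h ▸ hx)
  have hs : greenSign d * greenSign d = 1 := by
    unfold greenSign
    split_ifs <;> norm_num
  have h5 : ∫ y, pderivAt j (fun z => newtonFn d x z) y * (outwardNormal D y) i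
      ∂(surfaceMeasure D) = greenSign d *
        ∫ y, pderivAt j (fun z => greenFn d z y) x * (outwardNormal D y) i
          ∂(surfaceMeasure D) := by
    rw [← integral_const_mul]
    refine setIntegral_congr_fun isClosed_frontier.measurableSet fun y hy => ?_
    simp only [pderivAt_newtonFn hd (hne y hy), mul_assoc]
  rw [h5, h3]
  simp only [newtonAngular, mul_assoc]
  rw [integral_const_mul]
  linear_combination (-(kron i j / d)) * hs
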